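/- All graphs are finite and simple. Call a connected $d$-regular graph with $d\ge 1$ *Ramanujan* if every eigenvalue $\mu\neq d$ of its adjacency matrix satisfies $|\mu|\le 2\sqrt{d-1}$, and call a connected bipartite $d$-regular graph with $d\ge 1$ *bipartite Ramanujan* if every eigenvalue $\mu$ with $|\mu|<d$ satisfies $|\mu|\le 2\sqrt{d-1}$. Points are the one-dimensional subspaces of the vector space under consideration. **(1)** Let $m\ge 2$ and let $Q$ be a nondegenerate quadratic form on $\mathbb F_2^{2m}$. The largest totally singular subspaces have dimension $m$ (the hyperbolic case, $\varepsilon=+$) or $m-1$ (the elliptic case, $\varepsilon=-$). Let $NO^{\varepsilon}(2m,2)$ be the graph whose vertices are the non-singular points, distinct points being adjacent when they are orthogonal for the polar form of $Q$. Then $NO^{-}(2m,2)$ is Ramanujan for all $m\ge 2$, $NO^{+}(2m,2)$ is Ramanujan for all $m\ge 3$, and $NO^{+}(4,2)\cong K_{3,3}$ is bipartite Ramanujan. **(2)** Let $m\ge 2$ and let $Q$ be a nondegenerate quadratic form on $\mathbb F_2^{2m+1}$ (a parabolic quadric $Q(2m,2)$), with nucleus $N$, the point orthogonal to all points. Let $NO(2m+1,2)$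 be the graph whose vertices are the non-singular points other than $N$, distinct points being adjacent when orthogonal, and let $\Gamma_{Q(2m,2)}$ be the graph whose vertices are the singular points, distinct points being adjacent when the line joining them is contained in the quadric. Then $NO(2m+1,2)\cong\Gamma_{Q(2m,2)}$, and this graph is Ramanujan. **(3)** Let $m\ge 3$ and let $H$ be a nondegenerate Hermitian form on $\mathbb F_4^{m}$. Let $NU(m,4)$ be the graph whose vertices are the non-isotropic points, distinct points being adjacent when the line joining them is tangent, i.e. contains exactly one isotropic point. Then $NU(m,4)$ is Ramanujan. -/

import Mathlib

open scoped LinearAlgebra.Projectivization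

namespace PolarGraphs

/-! ### Ramanujan graphs -/

section Spectrum

variable {W : Type*} [Finite W]

open Classical in
/-- `μ` is an eigenvalue of the adjacency matrix of the finite graph `G`. -/
def IsGraphEigenvalue (G : SimpleGraph W) (μ : ℝ) : Prop :=
  letI : Fintype W := Fintype.ofFinite W
  Module.End.HasEigenvalue (Matrix.toLin' (G.adjMatrix ℝ)) μ

open Classical in
/-- Every vertex of the finite graph `G` has exactly `d` neighbours. -/
def IsRegular (G : SimpleGraph W) (d : ℕ) : Prop :=
  letI : Fintype W := Fintype.ofFinite W
  G.IsRegularOfDegree d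

/-- A Ramanujan graph: a connected `d`-regular graph with `d ≥ 1`, all of whose eigenvalues other
than `d` are at most `2 √(d - 1)` in absolute value. -/
def IsRamanujan (G : SimpleGraph W) : Prop :=
  G.Connected ∧ ∃ d : ℕ, 1 ≤ d ∧ IsRegular G d ∧
    ∀ μ : ℝ, IsGraphEigenvalue G μ → μ ≠ d → |μ| ≤ 2 * √((d : ℝ) - 1)

/-- A bipartite Ramanujan graph: a connected bipartite `d`-regular graph with `d ≥ 1`, all of whose
eigenvalues other than `± d` are at most `2 √(d - 1)` in absolute value. -/
def IsBipartiteRamanujan (G : SimpleGraph W) : Prop :=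
  G.Connected ∧ G.IsBipartite ∧ ∃ d : ℕ, 1 ≤ d ∧ IsRegular G d ∧
    ∀ μ : ℝ, IsGraphEigenvalue G μ → |μ| < d → |μ| ≤ 2 * √((d : ℝ) - 1)

end Spectrum

/-! ### Quadrics -/

section Quadric

variable {K V : Type*} [Field K] [AddCommGroup V] [Module K V]

/-- The point `p` lies on the quadric of `Q`. -/
def IsSingularPoint (Q : QuadraticForm K V) (p : ℙ K V) : Prop :=
  ∀ v ∈ p.submodule, Q v = 0

/-- The points `p` and `q` are orthogonal for the polar form of `Q`. -/
def IsOrthogonal (Q : QuadraticForm K V) (p q : ℙ K V) : Prop :=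
  ∀ v ∈ p.submodule, ∀ w ∈ q.submodule, QuadraticMap.polar Q v w = 0

/-- The point `p` is orthogonal to all points, i.e. it lies in all tangent hyperplanes of the
quadric. For a nondegenerate quadric in even projective dimension and in characteristic two there
is exactly one such point, the nucleus. -/
def IsNucleus (Q : QuadraticForm K V) (p : ℙ K V) : Prop :=
  ∀ q : ℙ K V, IsOrthogonal Q p q

/-- `r` is the (vector space) dimension of the largest totally singular subspaces. -/
def HasRank (Q : QuadraticForm K V) (r : ℕ) : Prop :=
  IsGreatest {k : ℕ | ∃ U : Submodule K V, (∀ v ∈ U, Q v = 0) ∧ Module.finrank K U = k} r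

/-- `Q` defines a hyperbolic quadric `Q⁺(2m-1, K)`. -/
structure IsHyperbolic (Q : QuadraticForm K V) (m : ℕ) : Prop where
  finrank_eq : Module.finrank K V = 2 * m
  nondegenerate : Q.Nondegenerate
  hasRank : HasRank Q m

/-- `Q` defines an elliptic quadric `Q⁻(2m-1, K)`. -/
structure IsElliptic (Q : QuadraticForm K V) (m : ℕ) : Prop where
  finrank_eq : Module.finrank K V = 2 * m
  nondegenerate : Q.Nondegenerate
  hasRank : ∃ r : ℕ, r + 1 = m ∧ HasRank Q r

/-- `Q` defines a parabolic quadric `Q(2m, K)`. -/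
structure IsParabolic (Q : QuadraticForm K V) (m : ℕ) : Prop where
  finrank_eq : Module.finrank K V = 2 * m + 1
  nondegenerate : Q.Nondegenerate

/-- The graph on the points off the quadric, distinct points being adjacent when orthogonal.
For a hyperbolic (`ε = +`) or elliptic (`ε = -`) quadric in `PG(2m-1, 2)` this is `NO^ε(2m, 2)`. -/
def graphNOEven (Q : QuadraticForm K V) :
    SimpleGraph {p : ℙ K V // ¬ IsSingularPoint Q p} where
  Adj p q := p ≠ q ∧ IsOrthogonal Q p.1 q.1
  symm := ⟨fun _ _ h => ⟨h.1.symm, fun v hv w hw =>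
    (QuadraticMap.polar_comm Q v w).trans (h.2 w hw v hv)⟩⟩
  loopless := ⟨fun _ h => h.1 rfl⟩

/-- The graph on the points that are neither on the quadric nor the nucleus, distinct points being
adjacent when orthogonal. For a parabolic quadric in `PG(2m, 2)` this is `NO(2m+1, 2)`. -/
def graphNOOdd (Q : QuadraticForm K V) :
    SimpleGraph {p : ℙ K V // ¬ IsSingularPoint Q p ∧ ¬ IsNucleus Q p} where
  Adj p q := p ≠ q ∧ IsOrthogonal Q p.1 q.1
  symm := ⟨fun _ _ h => ⟨h.1.symm, fun v hv w hw =>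
    (QuadraticMap.polar_comm Q v w).trans (h.2 w hw v hv)⟩⟩
  loopless := ⟨fun _ h => h.1 rfl⟩

/-- The collinearity graph of the quadric: the vertices are its points, and distinct points are
adjacent when the line joining them is contained in the quadric. -/
def collinearityGraph (Q : QuadraticForm K V) :
    SimpleGraph {p : ℙ K V // IsSingularPoint Q p} where
  Adj p q := p ≠ q ∧ ∀ v ∈ p.1.submodule ⊔ q.1.submodule, Q v = 0
  symm := ⟨fun p q h => ⟨h.1.symm, sup_comm p.1.submodule q.1.submodule ▸ h.2⟩⟩
  loopless := ⟨fun _ h => h.1 rfl⟩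

end Quadric

/-! ### Hermitian varieties -/

section Hermitian

variable {K V : Type*} [Field K] [AddCommGroup V] [Module K V] {σ : K →+* K}

/-- The point `p` lies on the Hermitian variety of `H`. -/
def IsIsotropicPoint (H : V →ₛₗ[σ] V →ₗ[K] K) (p : ℙ K V) : Prop :=
  ∀ v ∈ p.submodule, H v v = 0

/-- The subspace `L` (for us, a line) contains exactly one point of the Hermitian variety. -/
def IsTangent (H : V →ₛₗ[σ] V →ₗ[K] K) (L : Submodule K V) : Prop :=
  ∃! p : ℙ K V, p.submodule ≤ L ∧ IsIsotropicPoint H p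

/-- The graph on the points off the Hermitian variety, distinct points being adjacent when the line
joining them is tangent. For a nondegenerate Hermitian form on a space of dimension `m` over the
field with `q²` elements this is `NU(m, q²)`. -/
def graphNU (H : V →ₛₗ[σ] V →ₗ[K] K) :
    SimpleGraph {p : ℙ K V // ¬ IsIsotropicPoint H p} where
  Adj p q := p ≠ q ∧ IsTangent H (p.1.submodule ⊔ q.1.submodule)
  symm := ⟨fun p q h => ⟨h.1.symm, sup_comm p.1.submodule q.1.submodule ▸ h.2⟩⟩
  loopless := ⟨fun _ h => h.1 rfl⟩

end Hermitian

end PolarGraphs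

/-! Let B be the polar form of Q over F_2, χ the sign character `chi`, C the matrix with entries
χ(B(x, y)), and G = Σ χ(Q(z)) the Gauss sum. Points are nonzero vectors, and the orthogonality graph
on a set of them has adjacency matrix (J + C)/2 - I restricted to that set. An eigenvector for an
eigenvalue μ other than the degree has entry sum zero, so J disappears and the restricted C has
eigenvalue t = 2(μ + 1).

On nonsingular vectors, whose indicator is (1 - χ(Q))/2, the square of the restricted C has entries
(|V|[x = y] - χ(Q(x + y)) G)/2, and there χ(Q(x + y)) = χ(B(x, y)). Since G² = |V|
(`PolarNondegenerate.gaussSum_sq`), this gives (2t - G)(t + G) = 0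
(`PolarNondegenerate.eigenvalue_of_nonsingular`). With G = ±2^m the Ramanujan bound becomes an
inequality in 2^(m-1). The sign of G matters only for m = 2;
`PolarNondegenerate.gaussSum_eq_of_hasRank` reads it off a maximal totally singular subspace.

In the parabolic case, translation by the nucleus preserves B and exchanges singular and nonsingular
vectors. Now G = 0, and the same computation on singular vectors gives 2t² = |V|
(`eigenvalue_of_singular`).

In the Hermitian case H(v, v) lies in F_2 and is a quadratic form in 2m variables over F_2 with
polar form Tr H. Tangency of a line means H ≠ 0 on its two spanning points, a condition detected by
summing χ(Tr H) over scalar multiples (`sum_chi_trace₄_mul`). Functions constant on points then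
become eigenvectors of the same C, with t = -4(μ + 1). -/

namespace PolarGraphs

/-! ### Spectral criterion for connectedness and the Ramanujan property -/

section Criterion

variable {W W' : Type*}

open Classical in
/-- The entries of the adjacency matrix. -/
noncomputable def adj (G : SimpleGraph W) (x y : W) : ℝ := if G.Adj x y then 1 else 0

theorem adj_comm (G : SimpleGraph W) (x y : W) : adj G x y = adj G y x := by
  unfold adj
  classical exact if_congr (G.adj_comm x y) rfl rfl

theorem isRegular_iff [Fintype W] (G : SimpleGraph W) (d : ℕ) :
    IsRegular G d ↔ ∀ x, ∑ y, adj G x y = d := by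
  classical
  have hW : Finite W := inferInstance
  change @IsRegular W hW G d ↔ _
  obtain rfl : ‹Fintype W› = @Fintype.ofFinite W hW := Subsingleton.elim _ _
  unfold IsRegular SimpleGraph.IsRegularOfDegree
  refine forall_congr' fun x => ?_
  simp only [adj, Finset.sum_boole, ← SimpleGraph.card_neighborFinset_eq_degree,
    SimpleGraph.neighborFinset_eq_filter, Nat.cast_inj]

theorem isGraphEigenvalue_iff [Fintype W] (G : SimpleGraph W) (μ : ℝ) :
    IsGraphEigenvalue G μ ↔ ∃ f : W → ℝ, f ≠ 0 ∧ ∀ x, ∑ y, adj G x y * f y = μ * f x := by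
  classical
  have hW : Finite W := inferInstance
  change @IsGraphEigenvalue W hW G μ ↔ _
  obtain rfl : ‹Fintype W› = @Fintype.ofFinite W hW := Subsingleton.elim _ _
  unfold IsGraphEigenvalue
  constructor
  · intro h
    obtain ⟨f, hf⟩ := h.exists_hasEigenvector
    refine ⟨f, hf.2, fun x => ?_⟩
    have := congrFun hf.apply_eq_smul x
    simp only [Matrix.toLin'_apply, Matrix.mulVec, dotProduct, SimpleGraph.adjMatrix_apply,
      Pi.smul_apply, smul_eq_mul] at this
    exact this
  · rintro ⟨f, hf, h⟩
    refine Module.End.hasEigenvalue_of_hasEigenvector (x := f) ?_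
    rw [Module.End.hasEigenvector_iff, Module.End.mem_eigenspace_iff]
    refine ⟨?_, hf⟩
    ext x
    simp only [Matrix.toLin'_apply, Matrix.mulVec, dotProduct, SimpleGraph.adjMatrix_apply,
      Pi.smul_apply, smul_eq_mul]
    exact h x

theorem adj_iso {G : SimpleGraph W} {G' : SimpleGraph W'} (e : G ≃g G') (x y : W) :
    adj G' (e x) (e y) = adj G x y := by
  unfold adj
  classical exact if_congr e.map_adj_iff rfl rfl

theorem isRegular_iso [Finite W] [Finite W'] {G : SimpleGraph W} {G' : SimpleGraph W'}
    (e : G ≃g G') {d : ℕ} (h : IsRegular G' d) : IsRegular G d := by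
  have := Fintype.ofFinite W
  have := Fintype.ofFinite W'
  rw [isRegular_iff] at h ⊢
  intro x
  rw [← h (e x), ← e.toEquiv.sum_comp]
  exact Finset.sum_congr rfl fun y _ => (adj_iso e x y).symm

theorem isGraphEigenvalue_iso [Finite W] [Finite W'] {G : SimpleGraph W} {G' : SimpleGraph W'}
    (e : G ≃g G') {μ : ℝ} (h : IsGraphEigenvalue G μ) : IsGraphEigenvalue G' μ := by
  have := Fintype.ofFinite W
  have := Fintype.ofFinite W'
  rw [isGraphEigenvalue_iff] at h ⊢
  obtain ⟨f, hf, h⟩ := h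
  refine ⟨f ∘ e.symm, fun h0 => hf ?_, fun x => ?_⟩
  · ext x
    simpa using congrFun h0 (e x)
  · have hx := h (e.symm x)
    rw [Function.comp_apply, ← hx, ← e.toEquiv.sum_comp]
    refine Finset.sum_congr rfl fun y _ => ?_
    have := adj_iso e (e.symm x) y
    simp only [RelIso.apply_symm_apply] at this
    rw [← this]
    simp

theorem IsRamanujan.of_iso [Finite W] [Finite W'] {G : SimpleGraph W} {G' : SimpleGraph W'}
    (e : G ≃g G') (h : IsRamanujan G') : IsRamanujan G := by
  obtain ⟨hc, d, hd, hreg, hev⟩ := h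
  exact ⟨e.connected_iff.2 hc, d, hd, isRegular_iso e hreg,
    fun μ hμ => hev μ (isGraphEigenvalue_iso e hμ)⟩

theorem IsBipartiteRamanujan.of_iso [Finite W] [Finite W'] {G : SimpleGraph W}
    {G' : SimpleGraph W'} (e : G ≃g G') (h : IsBipartiteRamanujan G') :
    IsBipartiteRamanujan G := by
  obtain ⟨hc, hb, d, hd, hreg, hev⟩ := h
  exact ⟨e.connected_iff.2 hc, hb.of_hom e.toHom, d, hd, isRegular_iso e hreg,
    fun μ hμ => hev μ (isGraphEigenvalue_iso e hμ)⟩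

/-- In a regular graph, the entries of an eigenvector for an eigenvalue other than the degree
add up to zero. -/
theorem sum_eq_zero_of_eigenvector [Fintype W] {G : SimpleGraph W} {d : ℕ} (hreg : IsRegular G d)
    {f : W → ℝ} {μ : ℝ} (hf : ∀ x, ∑ y, adj G x y * f y = μ * f x) (hμ : μ ≠ d) :
    ∑ x, f x = 0 := by
  rw [isRegular_iff] at hreg
  have h1 : ∑ x, ∑ y, adj G x y * f y = μ * ∑ x, f x := by
    rw [Finset.mul_sum]
    exact Finset.sum_congr rfl fun x _ => hf x
  have h2 : ∑ x, ∑ y, adj G x y * f y = d * ∑ x, f x := by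
    rw [Finset.sum_comm, Finset.mul_sum]
    refine Finset.sum_congr rfl fun y _ => ?_
    rw [← Finset.sum_mul, ← hreg y]
    simp only [adj_comm]
  have h3 : (μ - d) * ∑ x, f x = 0 := by linarith
  exact (mul_eq_zero.1 h3).resolve_left (sub_ne_zero.2 hμ)

/-- A regular graph whose degree is not the eigenvalue of a vector with entries adding up to zero
is connected. -/
theorem connected_of_forall_eigenvector [Fintype W] [Nonempty W] {G : SimpleGraph W} {d : ℕ}
    (hreg : IsRegular G d)
    (h : ∀ f : W → ℝ, f ≠ 0 → ∑ x, f x = 0 → ¬ ∀ x, ∑ y, adj G x y * f y = d * f x) :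
    G.Connected := by
  classical
  refine (SimpleGraph.connected_iff _).2 ⟨fun a b => ?_, inferInstance⟩
  by_contra hab
  rw [isRegular_iff] at hreg
  -- The centred indicator of the component of `a` is an eigenvector for the degree with sum zero;
  -- it is nonzero because `b` lies outside the component.
  let g : W → ℝ := fun x => if G.Reachable a x then 1 else 0
  let c : ℝ := (∑ x, g x) / Fintype.card W
  have hW : (Fintype.card W : ℝ) ≠ 0 := by simp
  refine h (fun x => g x - c) (fun h0 => ?_) ?_ fun x => ?_
  · have ha := congrFun h0 a
    have hb := congrFun h0 b
    simp only [g, if_neg hab, SimpleGraph.Reachable.refl, if_true, Pi.zero_apply] at ha hb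
    linarith
  · rw [Finset.sum_sub_distrib, Finset.sum_const, Finset.card_univ, nsmul_eq_mul]
    simp only [c]
    field_simp
    ring
  · have : ∀ y, adj G x y * (g y - c) = adj G x y * (g x - c) := by
      intro y
      by_cases hxy : G.Adj x y
      · have : G.Reachable a x ↔ G.Reachable a y :=
          ⟨fun hx => hx.trans hxy.reachable, fun hy => hy.trans hxy.symm.reachable⟩
        simp only [g, this]
      · simp [adj, hxy]
    rw [Finset.sum_congr rfl fun y _ => this y, ← Finset.sum_mul, hreg x]

/-- The bound serves twice: as d² > 4(d - 1) for d ≥ 3, it also excludes eigenvectors of sum zero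
for d itself, which gives connectedness. -/
theorem isRamanujan_of_forall_eigenvector [Fintype W] [Nonempty W] {G : SimpleGraph W} {d : ℕ}
    (hd : 3 ≤ d) (hreg : IsRegular G d)
    (h : ∀ (f : W → ℝ) (μ : ℝ), f ≠ 0 → ∑ x, f x = 0 → (∀ x, ∑ y, adj G x y * f y = μ * f x) →
      μ ^ 2 ≤ 4 * ((d : ℝ) - 1)) :
    IsRamanujan G := by
  have hd' : (3 : ℝ) ≤ d := by exact_mod_cast hd
  refine ⟨connected_of_forall_eigenvector hreg fun f hf hs he => ?_, d, by omega, hreg,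
    fun μ hμ hne => ?_⟩
  · have := h f d hf hs he
    nlinarith
  · obtain ⟨f, hf, he⟩ := (isGraphEigenvalue_iff G μ).1 hμ
    have := h f μ hf (sum_eq_zero_of_eigenvector hreg he hne) he
    refine abs_le_of_sq_le_sq ?_ (by positivity)
    rw [mul_pow, Real.sq_sqrt (by linarith)]
    linarith

end Criterion

/-! ### The sign character of F_2 -/

section Character

/-- The nontrivial additive character of `ZMod 2`. -/
noncomputable def chi (a : ZMod 2) : ℝ := if a = 0 then 1 else -1

@[simp] theorem chi_zero : chi 0 = 1 := if_pos rfl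

@[simp] theorem chi_one : chi 1 = -1 := if_neg one_ne_zero

theorem zmod_two_cases (a : ZMod 2) : a = 0 ∨ a = 1 := by
  revert a; decide

theorem chi_add (a b : ZMod 2) : chi (a + b) = chi a * chi b := by
  rcases zmod_two_cases a with rfl | rfl <;> rcases zmod_two_cases b with rfl | rfl <;>
    simp [show (1 + 1 : ZMod 2) = 0 from rfl]

theorem chi_mul_self (a : ZMod 2) : chi a * chi a = 1 := by
  rw [← chi_add, CharTwo.add_self_eq_zero, chi_zero]

theorem half_one_sub_chi (a : ZMod 2) : (1 - chi a) / 2 = if a = 1 then 1 else 0 := by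
  rcases zmod_two_cases a with rfl | rfl <;> simp

theorem half_one_add_chi (a : ZMod 2) : (1 + chi a) / 2 = if a = 0 then 1 else 0 := by
  rcases zmod_two_cases a with rfl | rfl <;> simp

variable {V : Type*} [AddCommGroup V] [Fintype V]

/-- Translation by `a` flips the sign of every term. Additivity is required only in the direction
`a`, so that `φ` may be a quadratic form and `a` its nucleus. -/
theorem sum_chi_eq_zero {φ : V → ZMod 2} {a : V} (ha : φ a ≠ 0)
    (hφ : ∀ z, φ (z + a) = φ z + φ a) : ∑ z, chi (φ z) = 0 := by
  have ha1 : φ a = 1 := (zmod_two_cases _).resolve_left ha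
  have : ∑ z, chi (φ z) = ∑ z, -chi (φ z) := by
    rw [← Equiv.sum_comp (Equiv.addRight a)]
    refine Finset.sum_congr rfl fun z _ => ?_
    rw [Equiv.coe_addRight, hφ, ha1, chi_add, chi_one]
    ring
  rw [Finset.sum_neg_distrib] at this
  linarith

end Character

/-! ### Quadratic Gauss sums and the radical of the polar form -/

section GaussSum

variable {V : Type*} [AddCommGroup V] [Module (ZMod 2) V]
  (Q : QuadraticForm (ZMod 2) V)

open QuadraticMap

theorem chi_map_add (x y : V) : chi (Q (x + y)) = chi (Q x) * chi (Q y) * chi (polar Q x y) := by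
  rw [← chi_add, ← chi_add, polar]
  congr 1
  ring

theorem add_self_eq_zero_of_module (x : V) : x + x = 0 := by
  rw [← two_smul (ZMod 2) x, show (2 : ZMod 2) = 0 from rfl, zero_smul]

theorem add_eq_zero_iff_of_module (x y : V) : x + y = 0 ↔ x = y := by
  constructor
  · intro h
    rw [← add_zero x, ← add_self_eq_zero_of_module y, ← add_assoc, h, zero_add]
  · rintro rfl
    exact add_self_eq_zero_of_module x

theorem polar_self_eq_zero (x : V) : polar Q x x = 0 := by
  rw [polar_self, two_smul, CharTwo.add_self_eq_zero]

/-- The polar form of `Q` is nondegenerate. -/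
def PolarNondegenerate : Prop :=
  ∀ x, (∀ z, polar Q x z = 0) → x = 0

variable [Fintype V]

/-- The quadratic Gauss sum of a quadratic form over the field with two elements. -/
noncomputable def gaussSum : ℝ := ∑ z, chi (Q z)

open Classical in
theorem sum_chi_polar (x : V) :
    ∑ z, chi (polar Q x z) = if ∀ z, polar Q x z = 0 then (Fintype.card V : ℝ) else 0 := by
  split_ifs with h
  · simp [h]
  · push Not at h
    obtain ⟨a, ha⟩ := h
    exact sum_chi_eq_zero ha fun z => polar_add_right Q x z a

/-- Completing the square: Q(z) + B(w, z) = Q(z + w) - Q(w), and the sum is invariant under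
translation by w. -/
theorem sum_chi_mul_chi_polar (w : V) :
    ∑ z, chi (Q z) * chi (polar Q w z) = chi (Q w) * gaussSum Q := by
  rw [gaussSum, Finset.mul_sum, ← Equiv.sum_comp (Equiv.addRight w) fun z => chi (Q w) * chi (Q z)]
  refine Finset.sum_congr rfl fun z _ => ?_
  rw [Equiv.coe_addRight, chi_map_add, polar_comm Q w z]
  linear_combination - (chi (Q z) * chi (polar Q z w)) * chi_mul_self (Q w)

variable {Q}

open Classical in
theorem PolarNondegenerate.sum_chi_polar (hQ : PolarNondegenerate Q) (x : V) :
    ∑ z, chi (polar Q x z) = if x = 0 then (Fintype.card V : ℝ) else 0 := by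
  rw [PolarGraphs.sum_chi_polar]
  refine if_congr ⟨hQ x, ?_⟩ rfl rfl
  rintro rfl
  simp

/-- One factor is expanded over z and the other is twisted by z through `sum_chi_mul_chi_polar`;
summing over z first leaves only the term u = 0. -/
theorem PolarNondegenerate.gaussSum_sq (hQ : PolarNondegenerate Q) :
    gaussSum Q ^ 2 = Fintype.card V := by
  classical
  have h1 : ∀ z, chi (Q z) * gaussSum Q = ∑ u, chi (Q u) * chi (polar Q u z) := by
    intro z
    rw [← sum_chi_mul_chi_polar]
    simp only [polar_comm Q z]
  rw [_root_.sq]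
  conv_lhs => enter [1]; rw [gaussSum]
  rw [Finset.sum_mul, Finset.sum_congr rfl fun z _ => h1 z, Finset.sum_comm]
  simp_rw [← Finset.mul_sum, hQ.sum_chi_polar]
  simp

variable (Q) in
theorem exists_int_eq_gaussSum : ∃ n : ℤ, gaussSum Q = n := by
  refine ⟨∑ z, if Q z = 0 then 1 else -1, ?_⟩
  push_cast
  rfl

/-- The Gauss sum is an integer whose square is 2^dim, so no symplectic basis is needed. -/
theorem PolarNondegenerate.even_finrank (hQ : PolarNondegenerate Q) :
    Even (Module.finrank (ZMod 2) V) := by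
  obtain ⟨n, hn⟩ := exists_int_eq_gaussSum Q
  have h := hQ.gaussSum_sq
  rw [hn, Module.card_eq_pow_finrank (K := ZMod 2), ZMod.card] at h
  have h' : n ^ 2 = 2 ^ Module.finrank (ZMod 2) V := by exact_mod_cast h
  have h2 : n.natAbs ^ 2 = 2 ^ Module.finrank (ZMod 2) V := by
    zify
    rw [sq_abs, h']
  obtain ⟨k, -, hk⟩ := (Nat.dvd_prime_pow Nat.prime_two).1 (h2 ▸ dvd_pow_self n.natAbs two_ne_zero)
  rw [hk, ← pow_mul] at h2
  rw [← Nat.pow_right_injective le_rfl h2]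
  exact even_two.mul_left k

variable (Q) in
/-- The radical of the polar form of a quadratic form over the field with two elements has
even codimension. -/
theorem even_finrank_sub_finrank_ker :
    ∃ k, Module.finrank (ZMod 2) V = 2 * k + Module.finrank (ZMod 2) Q.polarBilin.ker := by
  -- On a complement of the radical the polar form is nondegenerate, so the complement has even
  -- dimension.
  obtain ⟨W, hW⟩ := Submodule.exists_isCompl Q.polarBilin.ker
  have := Fintype.ofFinite W
  have hnd : PolarNondegenerate (Q.comp W.subtype) := by
    intro x hx
    have : (x : V) ∈ Q.polarBilin.ker := by
      rw [LinearMap.mem_ker]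
      ext z
      obtain ⟨r, hr, w, hw, rfl⟩ := Submodule.mem_sup.1
        (hW.sup_eq_top ▸ Submodule.mem_top : z ∈ Q.polarBilin.ker ⊔ W)
      have h1 : polar Q x w = 0 := hx ⟨w, hw⟩
      have h2 : polar Q r x = 0 := congrArg (fun l => l x) (LinearMap.mem_ker.1 hr)
      rw [polarBilin_apply_apply, polar_add_right, h1, polar_comm, h2]
      simp
    exact Subtype.ext (Submodule.disjoint_def.1 hW.disjoint x this x.2)
  obtain ⟨k, hk⟩ := hnd.even_finrank
  refine ⟨k, ?_⟩
  rw [← Submodule.finrank_add_eq_of_isCompl hW, hk]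
  ring

/-- Nondegeneracy of `Q` allows the polar form a radical of dimension at most 1; the parity of the
codimension decides between 0 and 1. -/
theorem polarNondegenerate_of_finrank_eq (hQ : Q.Nondegenerate) {m : ℕ}
    (hm : Module.finrank (ZMod 2) V = 2 * m) : PolarNondegenerate Q := by
  obtain ⟨k, hk⟩ := even_finrank_sub_finrank_ker Q
  have h1 : Module.finrank (ZMod 2) Q.polarBilin.ker ≤ 1 := by
    have := hQ.rank_rad_polar_le
    rw [← Module.finrank_eq_rank] at this
    exact_mod_cast this
  have h0 : Module.finrank (ZMod 2) Q.polarBilin.ker = 0 := by omega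
  intro x hx
  rw [Submodule.finrank_eq_zero] at h0
  rw [← Submodule.mem_bot (ZMod 2), ← h0, LinearMap.mem_ker]
  ext z
  exact hx z

theorem exists_nucleus_of_finrank_eq (hQ : Q.Nondegenerate) {m : ℕ}
    (hm : Module.finrank (ZMod 2) V = 2 * m + 1) :
    ∃ n, Q n = 1 ∧ ∀ x, (∀ z, polar Q x z = 0) ↔ x = 0 ∨ x = n := by
  obtain ⟨k, hk⟩ := even_finrank_sub_finrank_ker Q
  have h1 : Module.finrank (ZMod 2) Q.polarBilin.ker ≤ 1 := by
    have := hQ.rank_rad_polar_le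
    rw [← Module.finrank_eq_rank] at this
    exact_mod_cast this
  have h0 : Module.finrank (ZMod 2) Q.polarBilin.ker = 1 := by omega
  obtain ⟨n, hn0, hn⟩ := finrank_eq_one_iff'.1 h0
  have hmem : ∀ x, (∀ z, polar Q x z = 0) ↔ x ∈ Q.polarBilin.ker := by
    intro x
    rw [LinearMap.mem_ker]
    exact ⟨fun h => LinearMap.ext h, fun h z => congrArg (fun l => l z) h⟩
  refine ⟨n, ?_, fun x => ⟨fun hx => ?_, ?_⟩⟩
  · refine (zmod_two_cases _).resolve_left fun h => hn0 ?_
    have : (n : V) ∈ Q.radical := ⟨h, n.2⟩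
    rw [hQ.radical_eq_bot, Submodule.mem_bot] at this
    exact Subtype.ext this
  · obtain ⟨c, hc⟩ := hn ⟨x, (hmem x).1 hx⟩
    have hc' : c • (n : V) = x := congrArg Subtype.val hc
    rcases zmod_two_cases c with rfl | rfl
    · left; rw [← hc', zero_smul]
    · right; rw [← hc', one_smul]
  · rintro (rfl | rfl)
    · simp
    · exact (hmem _).2 n.2

/-- A quadratic Gauss sum can be computed on the orthogonal complement of a totally singular
subspace. -/
theorem gaussSum_eq_sum_orthogonal {U : Submodule (ZMod 2) V} (hU : ∀ u ∈ U, Q u = 0)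
    (P : V → Prop) [DecidablePred P] (hP : ∀ z, P z ↔ ∀ u ∈ U, polar Q z u = 0) :
    gaussSum Q = ∑ z, if P z then chi (Q z) else 0 := by
  have := Fintype.ofFinite U
  have h1 : ∀ z, ∑ u : U, chi (polar Q z u) = if P z then (Fintype.card U : ℝ) else 0 := by
    intro z
    split_ifs with h
    · rw [hP] at h
      simp [fun u : U => h u u.2]
    · rw [hP] at h
      push Not at h
      obtain ⟨a, ha, hza⟩ := h
      exact sum_chi_eq_zero (a := (⟨a, ha⟩ : U)) hza fun u => polar_add_right Q z u a
  -- The double sum is evaluated twice: translation invariance gives |U| G, while Q(z + u) = Q(z) +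
  -- B(z, u) cancels every z outside the orthogonal complement of U.
  have h2 : ∑ u : U, ∑ z, chi (Q (z + u)) = Fintype.card U * gaussSum Q := by
    have : ∀ u : U, ∑ z, chi (Q (z + u)) = gaussSum Q := fun u =>
      Equiv.sum_comp (Equiv.addRight (u : V)) fun z => chi (Q z)
    simp [this]
  have h3 : ∑ u : U, ∑ z, chi (Q (z + u)) =
      Fintype.card U * ∑ z, if P z then chi (Q z) else 0 := by
    rw [Finset.sum_comm, Finset.mul_sum]
    refine Finset.sum_congr rfl fun z _ => ?_
    simp_rw [chi_map_add, fun u : U => hU u u.2, chi_zero, mul_one, ← Finset.mul_sum, h1]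
    split_ifs <;> ring
  have h4 : (Fintype.card U : ℝ) ≠ 0 := by simp
  exact mul_left_cancel₀ h4 (h2.symm.trans h3)

end GaussSum

open QuadraticMap

/-! ### Extension by zero of functions on a set of vectors -/

section Subtype

variable {V : Type*} [Fintype V]

theorem sum_subtype_mul_eq {P : V → Prop} [Fintype {v // P v}] {f : {v // P v} → ℝ} {F : V → ℝ}
    (h1 : ∀ v : {v // P v}, F v = f v) (h0 : ∀ v, ¬ P v → F v = 0) (g : V → ℝ) :
    ∑ v : {v // P v}, g v * f v = ∑ v, g v * F v := by
  refine Fintype.sum_of_injective Subtype.val Subtype.val_injective _ _ (fun v hv => ?_)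
    fun v => by rw [h1]
  rw [h0, mul_zero]
  simpa using hv

theorem sum_subtype_eq {P : V → Prop} [Fintype {v // P v}] {f : {v // P v} → ℝ} {F : V → ℝ}
    (h1 : ∀ v : {v // P v}, F v = f v) (h0 : ∀ v, ¬ P v → F v = 0) :
    ∑ v : {v // P v}, f v = ∑ v, F v := by
  simpa using sum_subtype_mul_eq h1 h0 fun _ => 1

end Subtype

/-! ### Orthogonality graphs and the quadratic equation for their eigenvalues -/

section PolarGraph

variable {V : Type*} [AddCommGroup V] [Module (ZMod 2) V] {Q : QuadraticForm (ZMod 2) V}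

/-- The graph on the vectors with a given property, distinct vectors being adjacent when they are
orthogonal for the polar form. -/
def polarGraph (Q : QuadraticForm (ZMod 2) V) (P : V → Prop) : SimpleGraph {v : V // P v} where
  Adj v w := v ≠ w ∧ polar Q v w = 0
  symm := ⟨fun v w h => ⟨h.1.symm, (polar_comm Q w v).trans h.2⟩⟩
  loopless := ⟨fun _ h => h.1 rfl⟩

open Classical in
-- The correction removes the diagonal: B(v, v) = 0, so the character term alone would put a loop at
-- every vertex.
theorem adj_polarGraph (P : V → Prop) (v w : {v : V // P v}) :
    adj (polarGraph Q P) v w = (1 + chi (polar Q v w)) / 2 - if w = v then 1 else 0 := by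
  rw [half_one_add_chi]
  unfold adj
  by_cases h : w = v
  · subst h
    rw [polar_self_eq_zero]
    simp
  · simp only [h, if_false, sub_zero]
    exact if_congr ⟨fun h => h.2, fun h' => ⟨fun e => h e.symm, h'⟩⟩ rfl rfl

variable [Fintype V]

theorem sum_adj_polarGraph {P : V → Prop} [Fintype {v // P v}] {f : {v // P v} → ℝ} {F : V → ℝ}
    (h1 : ∀ v : {v // P v}, F v = f v) (h0 : ∀ v, ¬ P v → F v = 0) (x : {v // P v}) :
    ∑ y, adj (polarGraph Q P) x y * f y =
      (∑ y, F y + ∑ y, chi (polar Q x y) * F y) / 2 - F x := by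
  classical
  simp_rw [adj_polarGraph, sub_mul, Finset.sum_sub_distrib, ite_mul, one_mul, zero_mul,
    Finset.sum_ite_eq', Finset.mem_univ, if_true, h1 x, ← sum_subtype_eq h1 h0,
    ← sum_subtype_mul_eq h1 h0, ← Finset.sum_add_distrib, Finset.sum_div]
  congr 1
  exact Finset.sum_congr rfl fun y _ => by ring

/-- An eigenvector of a graph `polarGraph Q P` extends to all vectors. -/
theorem exists_extension_of_eigenvector {P : V → Prop} [Fintype {v // P v}]
    {f : {v // P v} → ℝ} (hf : f ≠ 0) (hs : ∑ v, f v = 0) {μ : ℝ}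
    (he : ∀ x, ∑ y, adj (polarGraph Q P) x y * f y = μ * f x) :
    ∃ F : V → ℝ, (∀ v, F v ≠ 0 → P v) ∧ (∃ v, F v ≠ 0) ∧ ∑ v, F v = 0 ∧
      ∀ x, P x → ∑ y, chi (polar Q x y) * F y = 2 * (μ + 1) * F x := by
  classical
  let F : V → ℝ := fun v => if h : P v then f ⟨v, h⟩ else 0
  have h1 : ∀ v : {v // P v}, F v = f v := fun v => by simp [F, v.2]
  have h0 : ∀ v, ¬ P v → F v = 0 := fun v hv => by simp [F, hv]
  obtain ⟨a, ha⟩ := Function.ne_iff.1 hf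
  refine ⟨F, fun v => not_imp_comm.1 (h0 v), ⟨a, by rwa [h1]⟩, ?_, fun x hx => ?_⟩
  · rw [← sum_subtype_eq h1 h0, hs]
  · have := he ⟨x, hx⟩
    rw [sum_adj_polarGraph h1 h0, ← sum_subtype_eq h1 h0, hs, ← h1] at this
    linarith

theorem PolarNondegenerate.eigenvalue_of_nonsingular (hQ : PolarNondegenerate Q) {F : V → ℝ}
    (hF : ∀ v, F v ≠ 0 → Q v = 1) (hne : ∃ v, F v ≠ 0) {t : ℝ}
    (h : ∀ x, Q x = 1 → ∑ y, chi (polar Q x y) * F y = t * F x) :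
    t = gaussSum Q / 2 ∨ t = - gaussSum Q := by
  classical
  obtain ⟨a, ha⟩ := hne
  have h1 : ∀ z, t * F z = (1 - chi (Q z)) / 2 * ∑ y, chi (polar Q z y) * F y := by
    intro z
    rw [half_one_sub_chi]
    split_ifs with hz
    · rw [one_mul, h z hz]
    · rw [not_imp_comm.1 (hF z) hz, mul_zero, zero_mul]
  have h2 : ∀ w, ∑ z, (1 - chi (Q z)) / 2 * chi (polar Q w z) =
      ((if w = 0 then (Fintype.card V : ℝ) else 0) - chi (Q w) * gaussSum Q) / 2 := by
    intro w
    rw [← hQ.sum_chi_polar, ← sum_chi_mul_chi_polar, ← Finset.sum_sub_distrib, Finset.sum_div]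
    exact Finset.sum_congr rfl fun z _ => by ring
  have h3 : t * (t * F a) = (Fintype.card V * F a - gaussSum Q * (t * F a)) / 2 := by
    conv_lhs => rw [← h a (hF a ha), Finset.mul_sum]
    have h4 : ∀ z, t * (chi (polar Q a z) * F z) =
        ∑ y, F y * ((1 - chi (Q z)) / 2 * chi (polar Q (a + y) z)) := by
      intro z
      rw [mul_left_comm, h1, Finset.mul_sum, Finset.mul_sum]
      refine Finset.sum_congr rfl fun y _ => ?_
      rw [polar_add_left, chi_add, polar_comm Q z y]
      ring
    have h5 : ∀ y, F y * ∑ z, ((1 - chi (Q z)) / 2 * chi (polar Q (a + y) z)) =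
        ((if a = y then (Fintype.card V : ℝ) * F y else 0) -
          gaussSum Q * (chi (polar Q a y) * F y)) / 2 := by
      intro y
      rw [h2, add_eq_zero_iff_of_module]
      by_cases hy : F y = 0
      · simp [hy]
      -- Both `a` and `y` are nonsingular, so χ(Q(a + y)) = χ(B(a, y)): the square of C is expressed
      -- through C again.
      · rw [chi_map_add, hF y hy, hF a ha, chi_one]
        split_ifs <;> ring
    rw [Finset.sum_congr rfl fun z _ => h4 z, Finset.sum_comm]
    simp_rw [← Finset.mul_sum, h5]
    rw [← Finset.sum_div, Finset.sum_sub_distrib, ← Finset.mul_sum, h a (hF a ha)]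
    simp
  have h4 : (2 * t - gaussSum Q) * (t + gaussSum Q) = 0 := by
    rw [← mul_left_inj' ha, zero_mul]
    have := hQ.gaussSum_sq
    linear_combination 2 * h3 - F a * this
  rcases mul_eq_zero.1 h4 with h | h
  · left; linarith
  · right; linarith

/-- The Gauss sum of a nondegenerate form is determined by the dimension of the largest totally
singular subspaces. -/
theorem PolarNondegenerate.gaussSum_eq_of_hasRank (hQ : PolarNondegenerate Q) {r : ℕ}
    (hr : HasRank Q r) :
    gaussSum Q = 2 * 2 ^ r - 2 ^ (Module.finrank (ZMod 2) V - r) := by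
  classical
  obtain ⟨⟨U, hU, hUr⟩, hmax⟩ := hr
  have hnd : (polarBilin Q).Nondegenerate := by
    have hrefl : (polarBilin Q).IsRefl := fun x y h => (polar_comm Q y x).trans h
    exact hrefl.nondegenerate_iff_separatingLeft.2 hQ
  have hdim := LinearMap.BilinForm.finrank_orthogonal hnd U
  set O := LinearMap.BilinForm.orthogonal (polarBilin Q) U with hO
  have hmem : ∀ z, z ∈ O ↔ ∀ u ∈ U, polar Q z u = 0 := by
    intro z
    rw [hO, LinearMap.BilinForm.mem_orthogonal_iff]
    exact forall₂_congr fun u _ => by rw [polar_comm]; rfl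
  have hUO : ∀ z ∈ U, z ∈ O := by
    intro z hz
    rw [hmem]
    intro u hu
    simp [polar, hU u hu, hU z hz, hU _ (U.add_mem hz hu)]
  -- Maximality of U: a singular vector of its orthogonal complement outside U would extend it to a
  -- larger totally singular subspace.
  have hout : ∀ z ∈ O, z ∉ U → Q z = 1 := by
    intro z hz hzU
    refine (zmod_two_cases _).resolve_left fun h0 => ?_
    have hlt : U < U ⊔ Submodule.span (ZMod 2) {z} := by
      refine lt_of_le_of_ne le_sup_left fun he => hzU ?_
      rw [he]
      exact Submodule.mem_sup_right (Submodule.mem_span_singleton_self z)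
    have h1 := Submodule.finrank_lt_finrank_of_lt hlt
    have h2 := hmax ⟨U ⊔ Submodule.span (ZMod 2) {z}, ?_, rfl⟩
    · omega
    · intro v hv
      obtain ⟨u, hu, w, hw, rfl⟩ := Submodule.mem_sup.1 hv
      obtain ⟨c, rfl⟩ := Submodule.mem_span_singleton.1 hw
      rw [QuadraticMap.map_add Q, hU u hu, QuadraticMap.map_smul, h0, polar_smul_right, polar_comm,
        (hmem z).1 hz u hu]
      simp
  have hcard : ∀ S : Submodule (ZMod 2) V,
      ∑ z, (if z ∈ S then (1 : ℝ) else 0) = 2 ^ Module.finrank (ZMod 2) S := by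
    intro S
    rw [Finset.sum_boole, ← Fintype.card_subtype, Module.card_eq_pow_finrank (K := ZMod 2),
      ZMod.card]
    push_cast
    rfl
  rw [gaussSum_eq_sum_orthogonal hU (· ∈ O) hmem]
  -- Q is 0 on U and 1 on the rest of O, so the sum is |U| - (|O| - |U|).
  have : ∀ z, (if z ∈ O then chi (Q z) else 0) =
      2 * (if z ∈ U then (1 : ℝ) else 0) - (if z ∈ O then (1 : ℝ) else 0) := by
    intro z
    by_cases hzU : z ∈ U
    · simp [hzU, hUO z hzU, hU z hzU]
      norm_num
    · by_cases hzO : z ∈ O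
      · simp [hzU, hzO, hout z hzO hzU]
      · simp [hzU, hzO]
  rw [Finset.sum_congr rfl fun z _ => this z, Finset.sum_sub_distrib, ← Finset.mul_sum, hcard,
    hcard, hUr, hdim, hUr]

end PolarGraph

/-! ### Nonsingular vectors in even dimension -/

section EvenDimension

theorem PolarNondegenerate.nonempty_nonsingular {V : Type*} [AddCommGroup V]
    [Module (ZMod 2) V] {Q : QuadraticForm (ZMod 2) V} (hQ : PolarNondegenerate Q)
    {m : ℕ} (hm : 1 ≤ m)
    (hV : Module.finrank (ZMod 2) V = 2 * m) : Nonempty {v // Q v = 1} := by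
  by_contra hne
  rw [nonempty_subtype] at hne
  push Not at hne
  have h0 : ∀ v, Q v = 0 := fun v => (zmod_two_cases _).resolve_right (hne v)
  have : Nontrivial V := Module.nontrivial_of_finrank_pos (R := ZMod 2) (by omega)
  obtain ⟨v, hv⟩ := exists_ne (0 : V)
  exact hv (hQ v fun z => by simp [polar, h0])

variable {V : Type*} [AddCommGroup V] [Module (ZMod 2) V] [Fintype V]
  {Q : QuadraticForm (ZMod 2) V}

theorem card_eq_four_pow {m : ℕ} (hm : 1 ≤ m) (hV : Module.finrank (ZMod 2) V = 2 * m) :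
    (Fintype.card V : ℝ) = 4 * (2 ^ (m - 1)) ^ 2 := by
  obtain ⟨k, rfl⟩ := Nat.exists_eq_add_of_le' hm
  rw [Module.card_eq_pow_finrank (K := ZMod 2), hV, ZMod.card]
  push_cast
  rw [pow_mul, ← pow_mul 2 k, mul_comm k 2, pow_mul]
  ring

theorem PolarNondegenerate.gaussSum_eq_or (hQ : PolarNondegenerate Q) {m : ℕ} (hm : 1 ≤ m)
    (hV : Module.finrank (ZMod 2) V = 2 * m) :
    gaussSum Q = 2 * 2 ^ (m - 1) ∨ gaussSum Q = - (2 * 2 ^ (m - 1)) := by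
  rw [← sq_eq_sq_iff_eq_or_eq_neg, hQ.gaussSum_sq, card_eq_four_pow hm hV]
  ring

open Classical in
theorem sum_nonsingular : ∑ v, (if Q v = 1 then (1 : ℝ) else 0) =
    (Fintype.card V - gaussSum Q) / 2 := by
  simp_rw [← half_one_sub_chi]
  rw [← Finset.sum_div, Finset.sum_sub_distrib, gaussSum]
  simp

open Classical in
theorem PolarNondegenerate.sum_nonsingular_chi_polar (hQ : PolarNondegenerate Q) {x : V}
    (hx : Q x = 1) : ∑ v, chi (polar Q x v) * (if Q v = 1 then (1 : ℝ) else 0) =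
    gaussSum Q / 2 := by
  have hx0 : x ≠ 0 := by
    rintro rfl
    simp at hx
  have h1 := hQ.sum_chi_polar x
  have h2 := sum_chi_mul_chi_polar Q x
  rw [if_neg hx0] at h1
  rw [hx, chi_one] at h2
  have : ∀ v, chi (polar Q x v) * (if Q v = 1 then (1 : ℝ) else 0) =
      (chi (polar Q x v) - chi (Q v) * chi (polar Q x v)) / 2 := by
    intro v
    rw [← half_one_sub_chi]
    ring
  rw [Finset.sum_congr rfl fun v _ => this v, ← Finset.sum_div, Finset.sum_sub_distrib, h1, h2]
  ring

variable {m : ℕ}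

/-- The Gauss sum cancels between the number of vertices and the character sum, so both types have
degree |V|/4 - 1. -/
theorem PolarNondegenerate.isRegular_nonsingular (hQ : PolarNondegenerate Q) (hm : 1 ≤ m)
    (hV : Module.finrank (ZMod 2) V = 2 * m) :
    IsRegular (polarGraph Q fun v => Q v = 1) ((2 ^ (m - 1)) ^ 2 - 1) := by
  classical
  rw [isRegular_iff]
  intro x
  have h := sum_adj_polarGraph (Q := Q) (P := fun v => Q v = 1) (f := fun _ => 1)
    (F := fun v => if Q v = 1 then 1 else 0) (fun v => if_pos v.2) (fun v hv => if_neg hv) x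
  simp only [mul_one] at h
  rw [h, hQ.sum_nonsingular_chi_polar x.2, sum_nonsingular, card_eq_four_pow hm hV, if_pos x.2,
    Nat.cast_sub (Nat.one_le_pow _ _ (by positivity))]
  push_cast
  ring

theorem PolarNondegenerate.eigenvalue_polarGraph_nonsingular (hQ : PolarNondegenerate Q)
    {f : {v // Q v = 1} → ℝ} (hf : f ≠ 0) (hs : ∑ v, f v = 0) {μ : ℝ}
    (he : ∀ x, ∑ y, adj (polarGraph Q fun v => Q v = 1) x y * f y = μ * f x) :
    2 * (μ + 1) = gaussSum Q / 2 ∨ 2 * (μ + 1) = - gaussSum Q := by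
  obtain ⟨F, hF, hne, -, h⟩ := exists_extension_of_eigenvector hf hs he
  exact hQ.eigenvalue_of_nonsingular hF hne h

/-- With x = 2^(m-1), the critical eigenvalue is -x - 1 for positive Gauss sum. For x = 2 it equals
-3 and 9 > 4(d - 1) = 8, whence the excluded case. -/
theorem PolarNondegenerate.isRamanujan_nonsingular (hQ : PolarNondegenerate Q) (hm : 2 ≤ m)
    (hV : Module.finrank (ZMod 2) V = 2 * m)
    (h : 3 ≤ m ∨ gaussSum Q = - (2 * 2 ^ (m - 1))) :
    IsRamanujan (polarGraph Q fun v => Q v = 1) := by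
  have := hQ.nonempty_nonsingular (by omega) hV
  have h2 : 2 ^ 1 ≤ 2 ^ (m - 1) := Nat.pow_le_pow_right (by norm_num) (by omega)
  refine isRamanujan_of_forall_eigenvector ?_ (hQ.isRegular_nonsingular (by omega) hV) ?_
  · have : 2 * 2 ≤ (2 ^ (m - 1)) ^ 2 := by nlinarith
    omega
  · intro f μ hf hs he
    rw [Nat.cast_sub (Nat.one_le_pow _ _ (by positivity))]
    push_cast
    have h2' : (2 : ℝ) ≤ 2 ^ (m - 1) := by exact_mod_cast h2
    have hev := hQ.eigenvalue_polarGraph_nonsingular hf hs he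
    have hG := hQ.gaussSum_eq_or (by omega) hV
    have h4 : (4 : ℝ) ≤ 2 ^ (m - 1) ∨ gaussSum Q = - (2 * 2 ^ (m - 1)) := by
      refine h.imp_left fun h3 => ?_
      have : 2 ^ 2 ≤ 2 ^ (m - 1) := Nat.pow_le_pow_right (by norm_num) (by omega)
      exact_mod_cast this
    generalize (2 : ℝ) ^ (m - 1) = x at *
    rcases hG with hG | hG
    · have h4' : 4 ≤ x := h4.elim id fun h => by linarith
      rcases hev with hev | hev
      · obtain rfl : μ = x / 2 - 1 := by linarith
        nlinarith
      · obtain rfl : μ = - x - 1 := by linarith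
        nlinarith
    · rcases hev with hev | hev
      · obtain rfl : μ = - x / 2 - 1 := by linarith
        nlinarith
      · obtain rfl : μ = x - 1 := by linarith
        nlinarith

end EvenDimension

/-! ### Recognising K_{3,3} -/

section CompleteBipartite

variable {W : Type*} [Fintype W]

open Classical in
/-- A cubic graph on six vertices with three independent vertices is a complete bipartite
graph. -/
theorem nonempty_iso_completeBipartiteGraph {G : SimpleGraph W} (hW : Fintype.card W = 6)
    (hG : ∀ x, (Finset.univ.filter (G.Adj x)).card = 3) {A : Finset W} (hA : A.card = 3)
    (hind : ∀ a ∈ A, ∀ b ∈ A, ¬ G.Adj a b) :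
    Nonempty (G ≃g completeBipartiteGraph (Fin 3) (Fin 3)) := by
  have hAc : Aᶜ.card = 3 := by rw [Finset.card_compl, hW, hA]
  have h1 : ∀ a ∈ A, Finset.univ.filter (G.Adj a) = Aᶜ := by
    intro a ha
    refine Finset.eq_of_subset_of_card_le (fun b hb => ?_) (by rw [hAc, hG])
    rw [Finset.mem_compl]
    exact fun hbA => hind a ha b hbA (Finset.mem_filter.1 hb).2
  have h1' : ∀ a ∈ A, ∀ b, G.Adj a b ↔ b ∉ A := by
    intro a ha b
    rw [← Finset.mem_compl, ← h1 a ha]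
    simp
  have h2 : ∀ a ∉ A, A = Finset.univ.filter (G.Adj a) := by
    intro a ha
    refine Finset.eq_of_subset_of_card_le (fun b hb => ?_) (by rw [hA, hG])
    simpa using ((h1' b hb a).2 ha).symm
  have h2' : ∀ a ∉ A, ∀ b, G.Adj a b ↔ b ∈ A := by
    intro a ha b
    conv_rhs => rw [h2 a ha]
    simp
  let e₁ : {x // x ∈ A} ≃ Fin 3 := Fintype.equivFinOfCardEq (by simpa using hA)
  let e₂ : {x // x ∉ A} ≃ Fin 3 := Fintype.equivFinOfCardEq (by
    rw [Fintype.card_subtype_compl, hW]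
    simp [hA])
  let e : Fin 3 ⊕ Fin 3 ≃ W := (Equiv.sumCongr e₁ e₂).symm.trans (Equiv.sumCompl (· ∈ A))
  have hl : ∀ i, e (Sum.inl i) ∈ A := fun i => (e₁.symm i).2
  have hr : ∀ i, e (Sum.inr i) ∉ A := fun i => (e₂.symm i).2
  refine ⟨SimpleGraph.Iso.symm ⟨e, ?_⟩⟩
  rintro (i | i) (j | j)
  · simp [h1' _ (hl i), hl]
  · simp [h1' _ (hl i), hr]
  · simp [h2' _ (hr i), hl]
  · simp [h2' _ (hr i), hr]

end CompleteBipartite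

/-! ### The exceptional graph NO⁺(4, 2) -/

section Hyperbolic

variable {V : Type*} [AddCommGroup V] [Module (ZMod 2) V] [Fintype V]
  {Q : QuadraticForm (ZMod 2) V}

/-- The three vertices not adjacent to `x`, itself included, are x, a and x + a with B(x, a) = 1:
the nonzero vectors of an anisotropic plane. They are pairwise non-orthogonal and form one side of
the bipartition. -/
theorem PolarNondegenerate.nonempty_iso_completeBipartiteGraph (hQ : PolarNondegenerate Q)
    (hV : Module.finrank (ZMod 2) V = 4) (hG : gaussSum Q = 4) :
    Nonempty (polarGraph Q (fun v => Q v = 1) ≃g completeBipartiteGraph (Fin 3) (Fin 3)) := by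
  classical
  obtain ⟨x⟩ := hQ.nonempty_nonsingular (m := 2) (by norm_num) hV
  set G := polarGraph Q fun v => Q v = 1
  have hcard : Fintype.card {v // Q v = 1} = 6 := by
    have h := sum_nonsingular (Q := Q)
    rw [card_eq_four_pow (m := 2) (by norm_num) hV, hG, Finset.sum_boole,
      ← Fintype.card_subtype] at h
    norm_num at h
    exact_mod_cast h
  have hdeg : ∀ x, (Finset.univ.filter (G.Adj x)).card = 3 := by
    intro x
    have h := (isRegular_iff _ _).1 (hQ.isRegular_nonsingular (m := 2) (by norm_num) hV) x
    unfold adj at h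
    rw [Finset.sum_boole] at h
    norm_num at h
    exact_mod_cast h
  have hadj : ∀ a b, ¬ G.Adj a b ↔ a = b ∨ polar Q a b = 1 := by
    intro a b
    have : polar Q a b = 1 ↔ polar Q a b ≠ 0 := by
      rcases zmod_two_cases (polar Q a b) with h | h <;> simp [h]
    rw [this]
    change ¬ (a ≠ b ∧ polar Q a b = 0) ↔ _
    tauto
  have hA : ((Finset.univ.filter (G.Adj x))ᶜ).card = 3 := by
    rw [Finset.card_compl, hcard, hdeg]
  refine PolarGraphs.nonempty_iso_completeBipartiteGraph hcard hdeg hA fun a ha b hb => ?_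
  simp only [Finset.mem_compl, Finset.mem_filter, Finset.mem_univ, true_and] at ha hb
  by_cases hax : x = a
  · rwa [← hax]
  by_cases hbx : x = b
  · rw [← hbx, G.adj_comm]
    exact ha
  by_cases hab : a = b
  · exact (hadj _ _).2 (Or.inl hab)
  have ha1 : polar Q x a = 1 := ((hadj _ _).1 ha).resolve_left hax
  have hc : Q (x + a : V) = 1 := by
    rw [QuadraticMap.map_add Q, x.2, a.2, ha1]
    rfl
  let c : {v // Q v = 1} := ⟨x + a, hc⟩
  have hxc : polar Q x c = 1 := by
    simp only [c]
    rw [polar_add_right, polar_self_eq_zero, ha1, zero_add]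
  have hac : polar Q a c = 1 := by
    simp only [c]
    rw [polar_add_right, polar_self_eq_zero, polar_comm, ha1, add_zero]
  have hne : ∀ y : {v // Q v = 1}, polar Q y c = 1 → y ≠ c := by
    rintro y h rfl
    rw [polar_self_eq_zero] at h
    exact zero_ne_one h
  have hbc : b = c := by
    by_contra hbc
    -- Otherwise `x` would have four non-neighbours, counting itself.
    have hsub : ({x, a, c, b} : Finset {v // Q v = 1}) ⊆ (Finset.univ.filter (G.Adj x))ᶜ := by
      intro y hy
      simp only [Finset.mem_insert, Finset.mem_singleton] at hy
      simp only [Finset.mem_compl, Finset.mem_filter, Finset.mem_univ, true_and]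
      rcases hy with rfl | rfl | rfl | rfl
      · exact G.irrefl
      · exact ha
      · exact (hadj _ _).2 (Or.inr hxc)
      · exact hb
    have := Finset.card_le_card hsub
    rw [hA, Finset.card_insert_of_notMem, Finset.card_insert_of_notMem,
      Finset.card_pair (Ne.symm hbc)] at this
    · omega
    · simp [hne a hac, hab]
    · simp [hax, hne x hxc, hbx]
  rw [hbc]
  exact (hadj _ _).2 (Or.inr hac)

theorem PolarNondegenerate.isBipartiteRamanujan_nonsingular (hQ : PolarNondegenerate Q)
    (hV : Module.finrank (ZMod 2) V = 4) (hG : gaussSum Q = 4) :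
    IsBipartiteRamanujan (polarGraph Q fun v => Q v = 1) := by
  classical
  obtain ⟨e⟩ := hQ.nonempty_iso_completeBipartiteGraph hV hG
  have hreg := hQ.isRegular_nonsingular (m := 2) (by norm_num) hV
  norm_num at hreg
  have := hQ.nonempty_nonsingular (m := 2) (by norm_num) hV
  have hev : ∀ (f : {v // Q v = 1} → ℝ) (μ : ℝ), f ≠ 0 → ∑ v, f v = 0 →
      (∀ x, ∑ y, adj (polarGraph Q fun v => Q v = 1) x y * f y = μ * f x) → μ = 0 ∨ μ = -3 := by
    intro f μ hf hs he
    have := hQ.eigenvalue_polarGraph_nonsingular hf hs he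
    rw [hG] at this
    rcases this with h | h
    · left; linarith
    · right; linarith
  refine ⟨connected_of_forall_eigenvector hreg fun f hf hs he => ?_, ?_, 3, by norm_num, hreg,
    fun μ hμ hlt => ?_⟩
  · have := hev f _ hf hs he
    norm_num at this
  · exact SimpleGraph.Colorable.of_hom e.toHom
      ((SimpleGraph.CompleteBipartiteGraph.bicoloring (Fin 3) (Fin 3)).colorable)
  · obtain ⟨f, hf, he⟩ := (isGraphEigenvalue_iff _ μ).1 hμ
    rw [abs_lt] at hlt
    push_cast at hlt
    rcases hev f μ hf (sum_eq_zero_of_eigenvector hreg he (ne_of_lt (by exact_mod_cast hlt.2))) he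
      with rfl | rfl
    · rw [abs_zero]
      positivity
    · exact absurd hlt.1 (lt_irrefl _)

end Hyperbolic

/-! ### Singular vectors in odd dimension -/

section OddDimension

variable {V : Type*} [AddCommGroup V] [Module (ZMod 2) V] [Fintype V]
  {Q : QuadraticForm (ZMod 2) V} {n : V}

theorem gaussSum_eq_zero_of_nucleus (hn : Q n = 1) (h : ∀ z, polar Q n z = 0) :
    gaussSum Q = 0 := by
  refine sum_chi_eq_zero (a := n) (by rw [hn]; exact one_ne_zero) fun z => ?_
  rw [QuadraticMap.map_add Q, polar_comm, h, add_zero]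

open Classical in
theorem sum_singular_chi_polar (hn : Q n = 1) (h : ∀ x, (∀ z, polar Q x z = 0) ↔ x = 0 ∨ x = n)
    (w : V) : ∑ z, chi (polar Q w z) * (if Q z = 0 ∧ z ≠ 0 then (1 : ℝ) else 0) =
      (if w = 0 ∨ w = n then (Fintype.card V : ℝ) else 0) / 2 - 1 := by
  have h1 := sum_chi_polar Q w
  have h2 := sum_chi_mul_chi_polar Q w
  rw [gaussSum_eq_zero_of_nucleus hn ((h n).2 (Or.inr rfl)), mul_zero] at h2
  have : ∀ v, chi (polar Q w v) * (if Q v = 0 ∧ v ≠ 0 then (1 : ℝ) else 0) =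
      (chi (polar Q w v) + chi (Q v) * chi (polar Q w v)) / 2 - if v = 0 then 1 else 0 := by
    intro v
    have : (if Q v = 0 ∧ v ≠ 0 then (1 : ℝ) else 0) =
        (1 + chi (Q v)) / 2 - if v = 0 then 1 else 0 := by
      rw [half_one_add_chi]
      by_cases hv : v = 0
      · simp [hv]
      · simp [hv]
    rw [this]
    by_cases hv : v = 0
    · simp [hv]
    · simp only [hv, if_false]
      ring
  rw [Finset.sum_congr rfl fun v _ => this v, Finset.sum_sub_distrib, ← Finset.sum_div,
    Finset.sum_add_distrib, h1, h2, if_congr (h w) rfl rfl]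
  simp

theorem eigenvalue_of_singular (hn : Q n = 1)
    (h : ∀ x, (∀ z, polar Q x z = 0) ↔ x = 0 ∨ x = n) {F : V → ℝ}
    (hF : ∀ v, F v ≠ 0 → Q v = 0 ∧ v ≠ 0) (hne : ∃ v, F v ≠ 0) (hs : ∑ v, F v = 0) {t : ℝ}
    (ht : ∀ x, Q x = 0 ∧ x ≠ 0 → ∑ y, chi (polar Q x y) * F y = t * F x) :
    2 * t ^ 2 = Fintype.card V := by
  classical
  obtain ⟨a, ha⟩ := hne
  have h1 : ∀ z, t * F z = (if Q z = 0 ∧ z ≠ 0 then (1 : ℝ) else 0) *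
      ∑ y, chi (polar Q z y) * F y := by
    intro z
    split_ifs with hz
    · rw [one_mul, ht z hz]
    · rw [not_imp_comm.1 (hF z) hz, mul_zero, zero_mul]
  have h3 : t * (t * F a) = Fintype.card V * F a / 2 := by
    conv_lhs => rw [← ht a (hF a ha), Finset.mul_sum]
    have h4 : ∀ z, t * (chi (polar Q a z) * F z) =
        ∑ y, F y * (chi (polar Q (a + y) z) * if Q z = 0 ∧ z ≠ 0 then (1 : ℝ) else 0) := by
      intro z
      rw [mul_left_comm, h1, Finset.mul_sum, Finset.mul_sum]
      refine Finset.sum_congr rfl fun y _ => ?_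
      rw [polar_add_left, chi_add, polar_comm Q z y]
      ring
    have h5 : ∀ y, F y * ∑ z, (chi (polar Q (a + y) z) *
        if Q z = 0 ∧ z ≠ 0 then (1 : ℝ) else 0) =
        (if a = y then (Fintype.card V : ℝ) * F y / 2 else 0) - F y := by
      intro y
      rw [sum_singular_chi_polar hn h]
      by_cases hy : F y = 0
      · simp [hy]
      · have hay : a + y ≠ n := by
          intro e
          have h6 : polar Q a (a + y) = 0 := by
            rw [e, polar_comm]
            exact (h n).2 (Or.inr rfl) a
          rw [polar_add_right, polar_self_eq_zero, zero_add] at h6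
          rw [← e, QuadraticMap.map_add Q, (hF a ha).1, (hF y hy).1, h6] at hn
          simp at hn
        simp only [hay, or_false, add_eq_zero_iff_of_module]
        split_ifs <;> ring
    rw [Finset.sum_congr rfl fun z _ => h4 z, Finset.sum_comm]
    simp_rw [← Finset.mul_sum, h5]
    rw [Finset.sum_sub_distrib, hs]
    simp
  rw [← mul_left_inj' ha]
  linear_combination 2 * h3

theorem isRamanujan_singular {m : ℕ} (hm : 2 ≤ m)
    (hV : Module.finrank (ZMod 2) V = 2 * m + 1) (hn : Q n = 1)
    (h : ∀ x, (∀ z, polar Q x z = 0) ↔ x = 0 ∨ x = n) :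
    IsRamanujan (polarGraph Q fun v => Q v = 0 ∧ v ≠ 0) := by
  classical
  have hcard : (Fintype.card V : ℝ) = 8 * (2 ^ (m - 1)) ^ 2 := by
    obtain ⟨k, rfl⟩ := Nat.exists_eq_add_of_le' (show 1 ≤ m by omega)
    rw [Module.card_eq_pow_finrank (K := ZMod 2), hV, ZMod.card]
    push_cast
    rw [pow_succ, pow_mul, ← pow_mul 2 k, mul_comm k 2, pow_mul]
    ring
  have h2 : 2 ^ 1 ≤ 2 ^ (m - 1) := Nat.pow_le_pow_right (by norm_num) (by omega)
  have h2' : (2 : ℝ) ≤ 2 ^ (m - 1) := by exact_mod_cast h2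
  have hcount : ∑ v, (if Q v = 0 ∧ v ≠ 0 then (1 : ℝ) else 0) = 4 * (2 ^ (m - 1)) ^ 2 - 1 := by
    have h0 := sum_singular_chi_polar hn h 0
    simp only [polar_zero_left, chi_zero, one_mul, true_or, if_true, hcard] at h0
    rw [h0]
    ring
  have hne : Nonempty {v // Q v = 0 ∧ v ≠ 0} := by
    by_contra hne
    rw [nonempty_subtype, not_exists] at hne
    simp only [hne, if_false, Finset.sum_const_zero] at hcount
    nlinarith
  have hle : 2 ≤ 2 * (2 ^ (m - 1)) ^ 2 := by nlinarith
  have hreg : IsRegular (polarGraph Q fun v => Q v = 0 ∧ v ≠ 0) (2 * (2 ^ (m - 1)) ^ 2 - 2) := by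
    rw [isRegular_iff]
    intro x
    have hx := sum_adj_polarGraph (Q := Q) (P := fun v => Q v = 0 ∧ v ≠ 0) (f := fun _ => 1)
      (F := fun v => if Q v = 0 ∧ v ≠ 0 then 1 else 0) (fun v => if_pos v.2)
      (fun v hv => if_neg hv) x
    have hxn : ¬ ((x : V) = 0 ∨ (x : V) = n) := by
      rintro (h0 | h0)
      · exact x.2.2 h0
      · rw [← h0, x.2.1] at hn
        exact zero_ne_one hn
    simp only [mul_one] at hx
    rw [hx, sum_singular_chi_polar hn h, hcount, if_neg hxn, if_pos x.2, Nat.cast_sub hle]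
    push_cast
    ring
  refine isRamanujan_of_forall_eigenvector ?_ hreg ?_
  · have : 2 * 2 ≤ (2 ^ (m - 1)) ^ 2 := by nlinarith
    omega
  · intro f μ hf hs he
    obtain ⟨F, hF, hFne, hFs, hFt⟩ := exists_extension_of_eigenvector hf hs he
    have hμ := eigenvalue_of_singular hn h hF hFne hFs hFt
    rw [hcard] at hμ
    rw [Nat.cast_sub hle]
    push_cast
    generalize (2 : ℝ) ^ (m - 1) = x at *
    have : (μ + 1) ^ 2 = x ^ 2 := by linarith
    rcases sq_eq_sq_iff_eq_or_eq_neg.1 this with hμ | hμ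
    · obtain rfl : μ = x - 1 := by linarith
      nlinarith
    · obtain rfl : μ = - x - 1 := by linarith
      nlinarith

end OddDimension

section Points

variable {K V : Type*} [Field K] [AddCommGroup V] [Module K V] (Q : QuadraticForm K V)

theorem isSingularPoint_iff (p : ℙ K V) : IsSingularPoint Q p ↔ Q p.rep = 0 := by
  unfold IsSingularPoint
  rw [p.submodule_eq]
  refine ⟨fun h => h _ (Submodule.mem_span_singleton_self _), fun h v hv => ?_⟩
  obtain ⟨c, rfl⟩ := Submodule.mem_span_singleton.1 hv
  rw [QuadraticMap.map_smul, h, smul_zero]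

theorem isOrthogonal_iff (p q : ℙ K V) : IsOrthogonal Q p q ↔ polar Q p.rep q.rep = 0 := by
  unfold IsOrthogonal
  rw [p.submodule_eq, q.submodule_eq]
  refine ⟨fun h => h _ (Submodule.mem_span_singleton_self _) _
    (Submodule.mem_span_singleton_self _), fun h v hv w hw => ?_⟩
  obtain ⟨c, rfl⟩ := Submodule.mem_span_singleton.1 hv
  obtain ⟨d, rfl⟩ := Submodule.mem_span_singleton.1 hw
  rw [polar_smul_left, polar_smul_right, h, smul_zero, smul_zero]

theorem isNucleus_iff (p : ℙ K V) : IsNucleus Q p ↔ ∀ z, polar Q p.rep z = 0 := by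
  refine ⟨fun h z => ?_, fun h q => (isOrthogonal_iff Q p q).2 (h _)⟩
  by_cases hz : z = 0
  · rw [hz, polar_zero_right]
  · refine h (.mk K z hz) _ ?_ _ ?_
    · rw [p.submodule_eq]
      exact Submodule.mem_span_singleton_self _
    · rw [Projectivization.submodule_mk]
      exact Submodule.mem_span_singleton_self _

theorem forall_mem_sup_eq_zero_iff {p q : ℙ K V} (hp : IsSingularPoint Q p)
    (hq : IsSingularPoint Q q) :
    (∀ v ∈ p.submodule ⊔ q.submodule, Q v = 0) ↔ polar Q p.rep q.rep = 0 := by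
  have hp' := (isSingularPoint_iff Q p).1 hp
  have hq' := (isSingularPoint_iff Q q).1 hq
  rw [p.submodule_eq, q.submodule_eq]
  constructor
  · intro h
    have := h _ (Submodule.add_mem_sup (Submodule.mem_span_singleton_self p.rep)
      (Submodule.mem_span_singleton_self q.rep))
    rw [polar, this, hp', hq']
    simp
  · intro h v hv
    obtain ⟨x, hx, y, hy, rfl⟩ := Submodule.mem_sup.1 hv
    obtain ⟨c, rfl⟩ := Submodule.mem_span_singleton.1 hx
    obtain ⟨d, rfl⟩ := Submodule.mem_span_singleton.1 hy
    rw [QuadraticMap.map_add Q, QuadraticMap.map_smul, QuadraticMap.map_smul, hp', hq',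
      polar_smul_left, polar_smul_right, h]
    simp

end Points

section BinaryPoints

variable {V : Type*} [AddCommGroup V] [Module (ZMod 2) V] {Q : QuadraticForm (ZMod 2) V}

theorem rep_mk (v : V) (hv : v ≠ 0) : (Projectivization.mk (ZMod 2) v hv).rep = v := by
  obtain ⟨a, ha⟩ := Projectivization.exists_smul_eq_mk_rep (ZMod 2) v hv
  rw [← ha, Subsingleton.elim a 1, one_smul]

/-- Over the field with two elements, points correspond to nonzero vectors. -/
noncomputable def pointEquiv (P : ℙ (ZMod 2) V → Prop) (P' : V → Prop)
    (h : ∀ p, P p ↔ P' p.rep) (h0 : ∀ v, P' v → v ≠ 0) : {p // P p} ≃ {v // P' v} where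
  toFun p := ⟨p.1.rep, (h _).1 p.2⟩
  invFun v := ⟨.mk _ v.1 (h0 _ v.2), (h _).2 (by rw [rep_mk]; exact v.2)⟩
  left_inv p := Subtype.ext (Projectivization.mk_rep _)
  right_inv v := Subtype.ext (rep_mk _ _)

theorem ne_zero_of_map_eq_one {v : V} (h : Q v = 1) : v ≠ 0 := by
  rintro rfl
  simp at h

theorem eq_one_iff_ne_zero (a : ZMod 2) : a = 1 ↔ a ≠ 0 := by
  revert a; decide

theorem nonempty_iso_graphNOEven (Q : QuadraticForm (ZMod 2) V) :
    Nonempty (graphNOEven Q ≃g polarGraph Q fun v => Q v = 1) := by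
  refine ⟨pointEquiv _ _ (fun p => ?_) fun v => ne_zero_of_map_eq_one, fun {p q} => ?_⟩
  · rw [isSingularPoint_iff, eq_one_iff_ne_zero]
  · change _ ≠ _ ∧ polar Q p.1.rep q.1.rep = 0 ↔ p ≠ q ∧ IsOrthogonal Q p.1 q.1
    rw [isOrthogonal_iff, (Equiv.injective _).ne_iff]

theorem nonempty_iso_collinearityGraph (Q : QuadraticForm (ZMod 2) V) :
    Nonempty (collinearityGraph Q ≃g polarGraph Q fun v => Q v = 0 ∧ v ≠ 0) := by
  refine ⟨pointEquiv _ _ (fun p => ?_) fun v h => h.2, fun {p q} => ?_⟩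
  · rw [isSingularPoint_iff]
    exact ⟨fun h => ⟨h, p.rep_nonzero⟩, fun h => h.1⟩
  · change _ ≠ _ ∧ polar Q p.1.rep q.1.rep = 0 ↔ p ≠ q ∧ ∀ v ∈ _, Q v = 0
    rw [forall_mem_sup_eq_zero_iff Q p.2 q.2, (Equiv.injective _).ne_iff]

theorem nonempty_iso_graphNOOdd {n : V} (h : ∀ x, (∀ z, polar Q x z = 0) ↔ x = 0 ∨ x = n) :
    Nonempty (graphNOOdd Q ≃g polarGraph Q fun v => Q v = 1 ∧ v ≠ n) := by
  refine ⟨pointEquiv _ _ (fun p => ?_) fun v h => ne_zero_of_map_eq_one h.1, fun {p q} => ?_⟩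
  · rw [isSingularPoint_iff, eq_one_iff_ne_zero, isNucleus_iff, h]
    simp [p.rep_nonzero]
  · change _ ≠ _ ∧ polar Q p.1.rep q.1.rep = 0 ↔ p ≠ q ∧ IsOrthogonal Q p.1 q.1
    rw [isOrthogonal_iff, (Equiv.injective _).ne_iff]

/-- Translation by the nucleus exchanges singular and nonsingular vectors. -/
theorem nonempty_iso_polarGraph_singular {n : V} (hn : Q n = 1) (h : ∀ z, polar Q n z = 0) :
    Nonempty (polarGraph Q (fun v => Q v = 1 ∧ v ≠ n) ≃g
      polarGraph Q fun v => Q v = 0 ∧ v ≠ 0) := by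
  have hQ : ∀ v, Q (v + n) = Q v + 1 := fun v => by
    rw [QuadraticMap.map_add Q, hn, polar_comm, h, add_zero]
  let e : {v // Q v = 1 ∧ v ≠ n} ≃ {v // Q v = 0 ∧ v ≠ 0} :=
    (Equiv.addRight n).subtypeEquiv fun v => by
      rw [Equiv.coe_addRight, hQ, CharTwo.add_eq_zero, ne_eq, ne_eq, add_eq_zero_iff_of_module]
  refine ⟨e, fun {v w} => ?_⟩
  change e v ≠ e w ∧ polar Q (v + n) (w + n) = 0 ↔ v ≠ w ∧ polar Q v w = 0
  rw [e.injective.ne_iff, polar_add_left, polar_add_right, h, polar_comm Q v n, h, add_zero,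
    add_zero]

variable [Finite V] {m : ℕ}

theorem IsElliptic.isRamanujan_graphNOEven (hm : 2 ≤ m) (hQ : IsElliptic Q m) :
    IsRamanujan (graphNOEven Q) := by
  have := Fintype.ofFinite V
  obtain ⟨e⟩ := nonempty_iso_graphNOEven Q
  have hnd := polarNondegenerate_of_finrank_eq hQ.nondegenerate hQ.finrank_eq
  refine (hnd.isRamanujan_nonsingular hm hQ.finrank_eq (Or.inr ?_)).of_iso e
  obtain ⟨r, rfl, hr⟩ := hQ.hasRank
  rw [hnd.gaussSum_eq_of_hasRank hr, hQ.finrank_eq, show 2 * (r + 1) - r = r + 2 by omega,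
    Nat.add_sub_cancel]
  ring

theorem IsHyperbolic.isRamanujan_graphNOEven (hm : 3 ≤ m) (hQ : IsHyperbolic Q m) :
    IsRamanujan (graphNOEven Q) := by
  have := Fintype.ofFinite V
  obtain ⟨e⟩ := nonempty_iso_graphNOEven Q
  have hnd := polarNondegenerate_of_finrank_eq hQ.nondegenerate hQ.finrank_eq
  exact (hnd.isRamanujan_nonsingular (by omega) hQ.finrank_eq (Or.inl hm)).of_iso e

theorem IsHyperbolic.isBipartiteRamanujan_graphNOEven (hQ : IsHyperbolic Q 2) :
    Nonempty (graphNOEven Q ≃g completeBipartiteGraph (Fin 3) (Fin 3)) ∧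
      IsBipartiteRamanujan (graphNOEven Q) := by
  have := Fintype.ofFinite V
  obtain ⟨e⟩ := nonempty_iso_graphNOEven Q
  have hnd := polarNondegenerate_of_finrank_eq hQ.nondegenerate hQ.finrank_eq
  have hG : gaussSum Q = 4 := by
    rw [hnd.gaussSum_eq_of_hasRank hQ.hasRank, hQ.finrank_eq]
    norm_num
  obtain ⟨e'⟩ := hnd.nonempty_iso_completeBipartiteGraph hQ.finrank_eq hG
  exact ⟨⟨e.trans e'⟩, (hnd.isBipartiteRamanujan_nonsingular hQ.finrank_eq hG).of_iso e⟩

theorem IsParabolic.isRamanujan (hm : 2 ≤ m) (hQ : IsParabolic Q m) :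
    Nonempty (graphNOOdd Q ≃g collinearityGraph Q) ∧ IsRamanujan (graphNOOdd Q) ∧
      IsRamanujan (collinearityGraph Q) := by
  have := Fintype.ofFinite V
  obtain ⟨n, hn, h⟩ := exists_nucleus_of_finrank_eq hQ.nondegenerate hQ.finrank_eq
  obtain ⟨e₁⟩ := nonempty_iso_graphNOOdd h
  obtain ⟨e₂⟩ := nonempty_iso_polarGraph_singular hn ((h n).2 (Or.inr rfl))
  obtain ⟨e₃⟩ := nonempty_iso_collinearityGraph Q
  have hR := isRamanujan_singular hm hQ.finrank_eq hn h
  exact ⟨⟨(e₁.trans e₂).trans e₃.symm⟩, hR.of_iso (e₁.trans e₂), hR.of_iso e₃⟩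

end BinaryPoints

section FourElements

variable {K : Type*} [Field K]

open Classical in
/-- The absolute trace of the field with four elements. -/
noncomputable def trace₄ (a : K) : ZMod 2 := if a + a ^ 2 = 0 then 0 else 1

theorem eq_zero_or_eq_one_of_sq_eq {a : K} (h : a ^ 2 = a) : a = 0 ∨ a = 1 := by
  have : a * (a - 1) = 0 := by linear_combination h
  exact (mul_eq_zero.1 this).imp_right sub_eq_zero.1

theorem pow_four_of_card (hK : Nat.card K = 4) (a : K) : a ^ 4 = a := by
  have : Finite K := Nat.finite_of_card_ne_zero (by omega)
  have := Fintype.ofFinite K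
  have h := FiniteField.pow_card a
  rwa [← Nat.card_eq_fintype_card, hK] at h

@[simp] theorem trace₄_zero : trace₄ (0 : K) = 0 := by simp [trace₄]

variable [CharP K 2]

open Classical in
theorem ite_add_of_sq_eq {a b : K} (ha : a ^ 2 = a) (hb : b ^ 2 = b) :
    (if a + b = 0 then (0 : ZMod 2) else 1) =
      (if a = 0 then 0 else 1) + if b = 0 then 0 else 1 := by
  rcases eq_zero_or_eq_one_of_sq_eq ha with rfl | rfl <;>
  rcases eq_zero_or_eq_one_of_sq_eq hb with rfl | rfl <;>
  simp [CharTwo.add_self_eq_zero]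

theorem add_sq_sq_eq (hK : Nat.card K = 4) (a : K) : (a + a ^ 2) ^ 2 = a + a ^ 2 := by
  rw [CharTwo.add_sq]
  linear_combination pow_four_of_card hK a

theorem trace₄_add (hK : Nat.card K = 4) (a b : K) : trace₄ (a + b) = trace₄ a + trace₄ b := by
  unfold trace₄
  rw [← ite_add_of_sq_eq (add_sq_sq_eq hK a) (add_sq_sq_eq hK b), CharTwo.add_sq,
    add_add_add_comm]

theorem exists_trace₄_ne_zero (hK : Nat.card K = 4) :
    ∃ a : K, a ≠ 1 ∧ a ^ 3 = 1 ∧ trace₄ a ≠ 0 := by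
  classical
  have : Finite K := Nat.finite_of_card_ne_zero (by omega)
  have := Fintype.ofFinite K
  obtain ⟨a, ha⟩ : ∃ a : K, a ∉ ({0, 1} : Finset K) := by
    by_contra! h
    have := Finset.card_le_card (fun a _ => h a : (Finset.univ : Finset K) ⊆ {0, 1})
    rw [Finset.card_univ, ← Nat.card_eq_fintype_card, hK] at this
    have := Finset.card_le_two (a := (0 : K)) (b := 1)
    omega
  simp only [Finset.mem_insert, Finset.mem_singleton, not_or] at ha
  refine ⟨a, ha.2, ?_, ?_⟩
  · apply mul_left_cancel₀ ha.1
    linear_combination pow_four_of_card hK a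
  · unfold trace₄
    rw [if_neg]
    · exact one_ne_zero
    · intro h
      rw [CharTwo.add_eq_zero] at h
      rcases eq_zero_or_eq_one_of_sq_eq h.symm with h | h
      · exact ha.1 h
      · exact ha.2 h

open Classical in
theorem sum_units_chi_trace₄ [Fintype K] (hK : Nat.card K = 4) (a : K) :
    ∑ c : Kˣ, chi (trace₄ (a * c)) = 3 - 4 * if a ≠ 0 then 1 else 0 := by
  by_cases ha : a = 0
  · have : Fintype.card Kˣ = 3 := by
      rw [Fintype.card_units, ← Nat.card_eq_fintype_card, hK]
    simp [ha, this]
  · have h1 : ∑ c : K, chi (trace₄ (a * c)) = 0 := by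
      obtain ⟨b, -, -, hb⟩ := exists_trace₄_ne_zero hK
      refine sum_chi_eq_zero (a := a⁻¹ * b) (by rwa [mul_inv_cancel_left₀ ha]) fun z => ?_
      rw [mul_add, trace₄_add hK]
    have h2 : ∑ c : Kˣ, chi (trace₄ (a * c)) =
        ∑ c : K, (chi (trace₄ (a * c)) - if c = 0 then 1 else 0) := by
      refine Fintype.sum_of_injective Units.val Units.val_injective _ _ (fun c hc => ?_)
        fun c => by simp
      have : c = 0 := by
        by_contra h0
        exact hc ⟨Units.mk0 c h0, rfl⟩
      simp [this]
    rw [h2, Finset.sum_sub_distrib, h1]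
    simp [ha]
    norm_num

end FourElements

section Hermitian

variable {K V : Type*} [Field K] [CharP K 2] [AddCommGroup V] [Module K V]
  {H : V →ₛₗ[frobenius K 2] V →ₗ[K] K}

theorem isIsotropicPoint_mk_iff (v : V) (hv : v ≠ 0) :
    IsIsotropicPoint H (.mk K v hv) ↔ H v v = 0 := by
  unfold IsIsotropicPoint
  rw [Projectivization.submodule_mk]
  refine ⟨fun h => h _ (Submodule.mem_span_singleton_self _), fun h w hw => ?_⟩
  obtain ⟨c, rfl⟩ := Submodule.mem_span_singleton.1 hw
  simp [h]

theorem isIsotropicPoint_iff (p : ℙ K V) : IsIsotropicPoint H p ↔ H p.rep p.rep = 0 := by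
  conv_lhs => rw [← p.mk_rep]
  exact isIsotropicPoint_mk_iff _ _

theorem apply_swap (hH : H.IsSymm) (v w : V) : H w v = H v w ^ 2 := by
  rw [← LinearMap.isSymm_def.1 hH v w, frobenius_def]

theorem apply_self_sq (hH : H.IsSymm) (v : V) : H v v ^ 2 = H v v := (apply_swap hH v v).symm

theorem apply_self_eq_one (hH : H.IsSymm) {v : V} (hv : H v v ≠ 0) : H v v = 1 :=
  (eq_zero_or_eq_one_of_sq_eq (apply_self_sq hH v)).resolve_left hv

theorem apply_smul_add_smul (hH : H.IsSymm) {a b : V} (ha : H a a = 1) (hb : H b b = 1)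
    (c d : K) : H (c • a + d • b) (c • a + d • b) =
      c ^ 3 + d ^ 3 + c ^ 2 * d * H a b + c * d ^ 2 * H a b ^ 2 := by
  simp only [map_add, LinearMap.add_apply, map_smulₛₗ, LinearMap.smul_apply, smul_eq_mul,
    frobenius_def, RingHom.id_apply, ha, hb, apply_swap hH a b]
  ring

theorem apply_smul_self (v : V) (c : K) : H (c • v) (c • v) = c ^ 3 * H v v := by
  simp only [map_smulₛₗ, LinearMap.smul_apply, smul_eq_mul, frobenius_def, RingHom.id_apply]
  ring

theorem isTangent_span_sup_span_iff (hK : Nat.card K = 4) (hH : H.IsSymm) {a b : V}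
    (ha : H a a = 1) (hb : H b b = 1) (hab : ∀ c d : K, c • a + d • b = 0 → c = 0 ∧ d = 0) :
    IsTangent H (K ∙ a ⊔ K ∙ b) ↔ H a b ≠ 0 := by
  have hmem : ∀ c d : K, c • a + d • b ∈ K ∙ a ⊔ K ∙ b := fun c d =>
    Submodule.add_mem_sup (Submodule.smul_mem _ _ (Submodule.mem_span_singleton_self _))
      (Submodule.smul_mem _ _ (Submodule.mem_span_singleton_self _))
  have hne : ∀ c : K, c • a + (1 : K) • b ≠ 0 := fun c h => one_ne_zero (hab _ _ h).2
  have hle : ∀ c : K, (Projectivization.mk K _ (hne c)).submodule ≤ K ∙ a ⊔ K ∙ b := fun c => by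
    rw [Projectivization.submodule_mk, Submodule.span_singleton_le_iff_mem]
    exact hmem _ _
  have hcube : ∀ c : K, c ≠ 0 → c ^ 3 = 1 := fun c hc => by
    apply mul_left_cancel₀ hc
    linear_combination pow_four_of_card hK c
  have h2 : (2 : K) = 0 := CharTwo.two_eq_zero
  constructor
  · rintro ⟨p, -, hp⟩ h
    have hiso : ∀ c : K, c ^ 3 = 1 → IsIsotropicPoint H (.mk K _ (hne c)) := fun c hc => by
      rw [isIsotropicPoint_mk_iff, apply_smul_add_smul hH ha hb, h, hc]
      linear_combination h2
    obtain ⟨w, hw1, hw3, -⟩ := exists_trace₄_ne_zero hK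
    have h1 := hp _ ⟨hle 1, hiso 1 (one_pow 3)⟩
    have h2 := hp _ ⟨hle w, hiso w hw3⟩
    have h3 := h1.trans h2.symm
    rw [Projectivization.mk_eq_mk_iff'] at h3
    obtain ⟨u, hu⟩ := h3
    have h4 := hab (u * w - 1) (u - 1) (by
      rw [sub_smul, sub_smul, mul_smul, ← sub_eq_zero.2 hu]
      simp only [smul_add, one_smul]
      abel)
    have hu1 : u = 1 := sub_eq_zero.1 h4.2
    rw [hu1, one_mul] at h4
    exact hw1 (sub_eq_zero.1 h4.1)
  · intro h
    have h3 := hcube _ h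
    refine ⟨.mk K _ (hne (H a b)), ⟨hle _, ?_⟩, ?_⟩
    · rw [isIsotropicPoint_mk_iff, apply_smul_add_smul hH ha hb]
      linear_combination 2 * h2 + 3 * h3
    · rintro p ⟨hpL, hp⟩
      rw [isIsotropicPoint_iff] at hp
      have hpmem : p.rep ∈ K ∙ a ⊔ K ∙ b := by
        refine hpL ?_
        rw [p.submodule_eq]
        exact Submodule.mem_span_singleton_self _
      obtain ⟨x, hx, y, hy, hxy⟩ := Submodule.mem_sup.1 hpmem
      obtain ⟨c, rfl⟩ := Submodule.mem_span_singleton.1 hx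
      obtain ⟨d, rfl⟩ := Submodule.mem_span_singleton.1 hy
      rw [← hxy, apply_smul_add_smul hH ha hb] at hp
      have hcd : (c + d * H a b) ^ 3 = 0 := by
        linear_combination hp + d ^ 3 * h3 +
          (c ^ 2 * d * H a b + c * d ^ 2 * H a b ^ 2) * h2
      have hc : c = d * H a b := CharTwo.add_eq_zero.1 (pow_eq_zero_iff three_ne_zero |>.1 hcd)
      rw [← p.mk_rep, Projectivization.mk_eq_mk_iff']
      refine ⟨d, ?_⟩
      rw [← hxy, hc, smul_add, smul_smul, smul_smul, mul_one]

theorem isTangent_sup_iff (hK : Nat.card K = 4) (hH : H.IsSymm) {p q : ℙ K V} (hpq : p ≠ q)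
    (hp : ¬ IsIsotropicPoint H p) (hq : ¬ IsIsotropicPoint H q) :
    IsTangent H (p.submodule ⊔ q.submodule) ↔ H p.rep q.rep ≠ 0 := by
  rw [isIsotropicPoint_iff] at hp hq
  rw [p.submodule_eq, q.submodule_eq]
  refine isTangent_span_sup_span_iff hK hH (apply_self_eq_one hH hp) (apply_self_eq_one hH hq) ?_
  exact LinearIndependent.pair_iff.1 (Projectivization.linearIndependent_pair_iff_ne.2 hpq)

open Classical in
theorem adj_graphNU (hK : Nat.card K = 4) (hH : H.IsSymm)
    (p q : {p : ℙ K V // ¬ IsIsotropicPoint H p}) :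
    adj (graphNU H) p q = (if H p.1.rep q.1.rep ≠ 0 then 1 else 0) - if q = p then 1 else 0 := by
  unfold adj
  by_cases h : q = p
  · subst h
    have := q.2
    rw [isIsotropicPoint_iff] at this
    simp [this]
  · simp only [h, if_false, sub_zero]
    have hpq : p ≠ q := fun e => h e.symm
    refine if_congr ?_ rfl rfl
    change p ≠ q ∧ IsTangent H (p.1.submodule ⊔ q.1.submodule) ↔ _
    rw [isTangent_sup_iff hK hH (fun e => hpq (Subtype.ext e)) p.2 q.2]
    simp [hpq]

open Classical in
theorem polar_hermitian (hH : H.IsSymm) (v w : V) :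
    polar (fun v : V => if H v v = 0 then (0 : ZMod 2) else 1) v w = trace₄ (H v w) := by
  have h : H (v + w) (v + w) = (H v v + H w w) + (H v w + H v w ^ 2) := by
    rw [← apply_swap hH v w]
    simp only [map_add, LinearMap.add_apply]
    ring
  have h1 : (H v v + H w w) ^ 2 = H v v + H w w := by
    rw [CharTwo.add_sq, apply_self_sq hH, apply_self_sq hH]
  have h2 : (H v w + H v w ^ 2) ^ 2 = H v w + H v w ^ 2 := by
    have := apply_self_sq hH (v + w)
    rw [h, CharTwo.add_sq, h1] at this
    exact add_left_cancel this
  rw [polar, h, ite_add_of_sq_eq h1 h2, ite_add_of_sq_eq (apply_self_sq hH v) (apply_self_sq hH w),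
    trace₄]
  ring

/-- Nonisotropic vectors are the nonzero multiples of representatives of nonisotropic points. -/
theorem sum_eq_sum_nonisotropic [Fintype V] [Fintype Kˣ]
    [Fintype {p : ℙ K V // ¬ IsIsotropicPoint H p}]
    {f : {p : ℙ K V // ¬ IsIsotropicPoint H p} → ℝ} {F : V → ℝ}
    (h1 : ∀ p : {p : ℙ K V // ¬ IsIsotropicPoint H p}, ∀ c : Kˣ, F (c • p.1.rep) = f p)
    (h0 : ∀ v, H v v = 0 → F v = 0) (g : V → ℝ) :
    ∑ v, g v * F v = ∑ q, (∑ a : Kˣ, g (a • q.1.rep)) * f q := by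
  have hinj : Function.Injective fun x : {p : ℙ K V // ¬ IsIsotropicPoint H p} × Kˣ =>
      x.2 • x.1.1.rep := by
    rintro ⟨q, a⟩ ⟨r, b⟩ h
    replace h : a • q.1.rep = b • r.1.rep := h
    have hqr : q = r := by
      apply Subtype.ext
      rw [← q.1.mk_rep, ← r.1.mk_rep, Projectivization.mk_eq_mk_iff]
      exact ⟨a⁻¹ * b, by rw [mul_smul, ← h, inv_smul_smul]⟩
    subst hqr
    have : (a : K) = b := smul_left_injective K q.1.rep_nonzero h
    rw [Units.ext this]
  simp_rw [Finset.sum_mul]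
  rw [← Fintype.sum_prod_type']
  refine (Fintype.sum_of_injective _ hinj _ _ (fun v hv => ?_) fun x => by rw [h1]).symm
  have : H v v = 0 := by
    by_contra h
    have hv0 : v ≠ 0 := by
      rintro rfl
      simp at h
    obtain ⟨a, ha⟩ := Projectivization.exists_smul_eq_mk_rep K v hv0
    refine hv ⟨⟨⟨.mk K v hv0, by rwa [isIsotropicPoint_mk_iff]⟩, a⁻¹⟩, ?_⟩
    simp only
    rw [← ha, inv_smul_smul]
  rw [h0 v this, mul_zero]

theorem sum_eq_three_mul_sum [Fintype V] (hK : Nat.card K = 4)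
    [Fintype {p : ℙ K V // ¬ IsIsotropicPoint H p}]
    {f : {p : ℙ K V // ¬ IsIsotropicPoint H p} → ℝ} {F : V → ℝ}
    (h1 : ∀ p : {p : ℙ K V // ¬ IsIsotropicPoint H p}, ∀ c : Kˣ, F (c • p.1.rep) = f p)
    (h0 : ∀ v, H v v = 0 → F v = 0) : ∑ v, F v = 3 * ∑ q, f q := by
  classical
  have : Finite K := Nat.finite_of_card_ne_zero (by omega)
  have := Fintype.ofFinite K
  have hcard : Fintype.card Kˣ = 3 := by
    rw [Fintype.card_units, ← Nat.card_eq_fintype_card, hK]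
  simpa [hcard, ← Finset.mul_sum] using sum_eq_sum_nonisotropic h1 h0 fun _ => 1

theorem sum_chi_trace₄_mul [Fintype V] (hK : Nat.card K = 4) (hH : H.IsSymm)
    [Fintype {p : ℙ K V // ¬ IsIsotropicPoint H p}]
    {f : {p : ℙ K V // ¬ IsIsotropicPoint H p} → ℝ} {F : V → ℝ}
    (h1 : ∀ p : {p : ℙ K V // ¬ IsIsotropicPoint H p}, ∀ c : Kˣ, F (c • p.1.rep) = f p)
    (h0 : ∀ v, H v v = 0 → F v = 0) (p : {p : ℙ K V // ¬ IsIsotropicPoint H p}) (c : Kˣ) :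
    ∑ v, chi (trace₄ (H (c • p.1.rep) v)) * F v =
      3 * ∑ q, f q - 4 * (∑ q, adj (graphNU H) p q * f q + f p) := by
  classical
  have : Finite K := Nat.finite_of_card_ne_zero (by omega)
  have := Fintype.ofFinite K
  have hunits : ∀ q : {p : ℙ K V // ¬ IsIsotropicPoint H p},
      (∑ a : Kˣ, chi (trace₄ (H (c • p.1.rep) (a • q.1.rep)))) * f q =
        3 * f q - 4 * ((adj (graphNU H) p q + if q = p then 1 else 0) * f q) := by
    intro q
    have h2 : ∀ a : Kˣ, H (c • p.1.rep) (a • q.1.rep) = H (c • p.1.rep) q.1.rep * a := by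
      intro a
      rw [Units.smul_def a, map_smul, smul_eq_mul, mul_comm]
    have h3 : H (c • p.1.rep) q.1.rep ≠ 0 ↔ H p.1.rep q.1.rep ≠ 0 := by
      rw [Units.smul_def, map_smulₛₗ, LinearMap.smul_apply, smul_eq_mul, frobenius_def]
      simp
    simp_rw [h2]
    rw [sum_units_chi_trace₄ hK, adj_graphNU hK hH, if_congr h3 rfl rfl]
    ring
  rw [sum_eq_sum_nonisotropic h1 h0, Finset.sum_congr rfl fun q _ => hunits q,
    Finset.sum_sub_distrib, ← Finset.mul_sum, ← Finset.mul_sum]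
  simp [add_mul, Finset.sum_add_distrib]

section QuadraticForm

variable [Module (ZMod 2) V]

open Classical in
/-- A Hermitian form over the field with four elements, as a quadratic form over the field with
two elements. -/
noncomputable def hermitianQuadraticForm (hK : Nat.card K = 4) (hH : H.IsSymm) :
    QuadraticForm (ZMod 2) V :=
  QuadraticMap.ofPolar (fun v => if H v v = 0 then 0 else 1)
    (fun a v => by rcases zmod_two_cases a with rfl | rfl <;> simp)
    (fun v w z => by
      simp only [polar_hermitian hH]
      rw [map_add, LinearMap.add_apply, trace₄_add hK])
    (fun a v w => by
      simp only [polar_hermitian hH]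
      rcases zmod_two_cases a with rfl | rfl <;> simp)

variable (hK : Nat.card K = 4) (hH : H.IsSymm)

theorem hermitianQuadraticForm_eq_one_iff (v : V) :
    hermitianQuadraticForm hK hH v = 1 ↔ H v v ≠ 0 := by
  classical
  change (if H v v = 0 then (0 : ZMod 2) else 1) = 1 ↔ _
  split_ifs with h <;> simp [h]

theorem polar_hermitianQuadraticForm (v w : V) :
    polar (hermitianQuadraticForm hK hH) v w = trace₄ (H v w) :=
  polar_hermitian hH v w

theorem polarNondegenerate_hermitianQuadraticForm (hnd : H.Nondegenerate) :
    PolarNondegenerate (hermitianQuadraticForm hK hH) := by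
  intro x hx
  refine hnd.1 x fun y => ?_
  by_contra hy
  obtain ⟨a, -, -, ha⟩ := exists_trace₄_ne_zero hK
  apply ha
  have := hx ((a * (H x y)⁻¹) • y)
  rwa [polar_hermitianQuadraticForm, map_smul, smul_eq_mul, inv_mul_cancel_right₀ hy] at this

variable [Fintype V]

theorem PolarNondegenerate.isRamanujan_graphNU {m : ℕ} (hm : 3 ≤ m)
    (hV : Module.finrank (ZMod 2) V = 2 * m)
    (hQ : PolarNondegenerate (hermitianQuadraticForm hK hH)) : IsRamanujan (graphNU H) := by
  classical
  have := Fintype.ofFinite {p : ℙ K V // ¬ IsIsotropicPoint H p}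
  set Q := hermitianQuadraticForm hK hH
  have hQ1 : ∀ v, Q v = 1 ↔ H v v ≠ 0 := hermitianQuadraticForm_eq_one_iff hK hH
  have hpolar : ∀ v w, polar Q v w = trace₄ (H v w) := polar_hermitianQuadraticForm hK hH
  have hpoint : ∀ v, Q v = 1 → ∃ (p : {p : ℙ K V // ¬ IsIsotropicPoint H p}) (c : Kˣ),
      c • p.1.rep = v := by
    intro v hv
    obtain ⟨a, ha⟩ := Projectivization.exists_smul_eq_mk_rep K v (ne_zero_of_map_eq_one hv)
    exact ⟨⟨.mk K v (ne_zero_of_map_eq_one hv),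
      by rwa [isIsotropicPoint_mk_iff, ← ne_eq, ← hQ1]⟩, a⁻¹, by rw [← ha, inv_smul_smul]⟩
  have hrep : ∀ (p : {p : ℙ K V // ¬ IsIsotropicPoint H p}) (c : Kˣ), Q (c • p.1.rep) = 1 := by
    intro p c
    rw [hQ1, Units.smul_def, apply_smul_self]
    exact mul_ne_zero (pow_ne_zero _ c.ne_zero) ((isIsotropicPoint_iff p.1).not.1 p.2)
  have hne : Nonempty {p : ℙ K V // ¬ IsIsotropicPoint H p} := by
    obtain ⟨v, hv⟩ := hQ.nonempty_nonsingular (by omega) hV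
    obtain ⟨p, -⟩ := hpoint v hv
    exact ⟨p⟩
  have hrow : ∀ p, ∑ q, adj (graphNU H) p q = (Fintype.card V - 2 * gaussSum Q) / 8 - 1 := by
    intro p
    have h1 : ∀ c : Kˣ, _ := sum_chi_trace₄_mul (f := fun _ => 1)
      (F := fun v => if Q v = 1 then (1 : ℝ) else 0) hK hH (fun p c => if_pos (hrep p c))
      (fun v hv => if_neg fun h => (hQ1 v).1 h hv) p
    have h2 := sum_eq_three_mul_sum hK (f := fun _ => 1)
      (F := fun v => if Q v = 1 then (1 : ℝ) else 0) (fun p c => if_pos (hrep p c))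
      (fun v hv => if_neg fun h => (hQ1 v).1 h hv)
    have h3 := h1 1
    simp_rw [← hpolar] at h3
    rw [hQ.sum_nonsingular_chi_polar (hrep p 1), ← h2, sum_nonsingular] at h3
    simp only [mul_one] at h3
    linarith
  have hX : (4 : ℝ) ≤ 2 ^ (m - 1) := by
    have : 2 ^ 2 ≤ 2 ^ (m - 1) := Nat.pow_le_pow_right (by norm_num) (by omega)
    exact_mod_cast this
  have hcard := card_eq_four_pow (by omega) hV
  have hG := hQ.gaussSum_eq_or (by omega) hV
  have hd : 4 ≤ (Fintype.card V - 2 * gaussSum Q) / 8 := by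
    rw [hcard]
    rcases hG with hG | hG <;> rw [hG] <;> nlinarith
  obtain ⟨d, hreg⟩ : ∃ d : ℕ, (d : ℝ) = (Fintype.card V - 2 * gaussSum Q) / 8 - 1 := by
    obtain ⟨p⟩ := hne
    refine ⟨(Finset.univ.filter ((graphNU H).Adj p)).card, ?_⟩
    rw [← hrow p]
    unfold adj
    rw [Finset.sum_boole]
  refine isRamanujan_of_forall_eigenvector (d := d) ?_ ?_ ?_
  · have : (3 : ℝ) ≤ d := by linarith
    exact_mod_cast this
  · rw [isRegular_iff]
    intro p
    rw [hrow, hreg]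
  · intro f μ hf hs he
    let F : V → ℝ := fun v =>
      if h : H v v ≠ 0 then f ⟨.mk K v (by rintro rfl; simp at h), by
        rwa [isIsotropicPoint_mk_iff]⟩ else 0
    have h1 : ∀ p : {p : ℙ K V // ¬ IsIsotropicPoint H p}, ∀ c : Kˣ,
        F (c • p.1.rep) = f p := by
      intro p c
      simp only [F, dif_pos ((hQ1 _).1 (hrep p c))]
      congr 1
      apply Subtype.ext
      conv_rhs => rw [← p.1.mk_rep]
      rw [Projectivization.mk_eq_mk_iff]
      exact ⟨c, rfl⟩
    have h0 : ∀ v, H v v = 0 → F v = 0 := fun v hv => dif_neg (not_not.2 hv)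
    obtain ⟨p, hp⟩ := Function.ne_iff.1 hf
    have hev := hQ.eigenvalue_of_nonsingular (F := F) (t := - 4 * (μ + 1))
      (fun v hv => (hQ1 v).2 fun h => hv (h0 v h)) ⟨(1 : Kˣ) • p.1.rep, by rwa [h1]⟩ ?_
    · rw [hreg, hcard]
      generalize (2 : ℝ) ^ (m - 1) = x at *
      rcases hG with hG | hG <;> rw [hG] at hev ⊢ <;> rcases hev with hev | hev
      · obtain rfl : μ = - x / 4 - 1 := by linarith
        nlinarith
      · obtain rfl : μ = x / 2 - 1 := by linarith
        nlinarith
      · obtain rfl : μ = x / 4 - 1 := by linarith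
        nlinarith
      · obtain rfl : μ = - x / 2 - 1 := by linarith
        nlinarith
    · intro x hx
      obtain ⟨q, c, rfl⟩ := hpoint x hx
      simp_rw [hpolar]
      rw [sum_chi_trace₄_mul hK hH h1 h0, hs, he, h1]
      ring

end QuadraticForm

theorem isRamanujan_graphNU [Finite V] {m : ℕ} (hm : 3 ≤ m) (hK : Nat.card K = 4)
    (hV : Module.finrank K V = m) (hH : H.IsSymm) (hnd : H.Nondegenerate) :
    IsRamanujan (graphNU H) := by
  have := Fintype.ofFinite V
  have : Finite K := Nat.finite_of_card_ne_zero (by omega)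
  let : Module (ZMod 2) V := AddCommGroup.zmodModule fun v => by
    rw [← Nat.cast_smul_eq_nsmul K, CharP.cast_eq_zero, zero_smul]
  have hV2 : Module.finrank (ZMod 2) V = 2 * m := by
    have h1 := Module.natCard_eq_pow_finrank (K := K) (V := V)
    have h2 := Module.natCard_eq_pow_finrank (K := ZMod 2) (V := V)
    rw [h2, hK, hV, Nat.card_zmod, show 4 = 2 ^ 2 from rfl, ← pow_mul] at h1
    exact Nat.pow_right_injective le_rfl h1
  exact (polarNondegenerate_hermitianQuadraticForm hK hH hnd).isRamanujan_graphNU hK hH hm hV2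

end Hermitian

end PolarGraphs

theorem theorem1 :
    -- the graphs `NO^ε(2m, 2)`
    (∀ (m : ℕ) (V : Type*) [AddCommGroup V] [Module (ZMod 2) V] [Finite V]
      (Q : QuadraticForm (ZMod 2) V), 2 ≤ m →
      (PolarGraphs.IsElliptic Q m → PolarGraphs.IsRamanujan (PolarGraphs.graphNOEven Q)) ∧
      (PolarGraphs.IsHyperbolic Q m → 3 ≤ m →
        PolarGraphs.IsRamanujan (PolarGraphs.graphNOEven Q)) ∧
      (PolarGraphs.IsHyperbolic Q m → m = 2 →
        Nonempty (PolarGraphs.graphNOEven Q ≃g completeBipartiteGraph (Fin 3) (Fin 3)) ∧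
        PolarGraphs.IsBipartiteRamanujan (PolarGraphs.graphNOEven Q))) ∧
    -- the graphs `NO(2m+1, 2)`
    (∀ (m : ℕ) (V : Type*) [AddCommGroup V] [Module (ZMod 2) V] [Finite V]
      (Q : QuadraticForm (ZMod 2) V), 2 ≤ m → PolarGraphs.IsParabolic Q m →
      Nonempty (PolarGraphs.graphNOOdd Q ≃g PolarGraphs.collinearityGraph Q) ∧
      PolarGraphs.IsRamanujan (PolarGraphs.graphNOOdd Q) ∧
      PolarGraphs.IsRamanujan (PolarGraphs.collinearityGraph Q)) ∧
    -- the graphs `NU(m, 4)`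
    (∀ (m : ℕ) (K V : Type*) [Field K] [CharP K 2] [AddCommGroup V] [Module K V] [Finite V]
      (H : V →ₛₗ[frobenius K 2] V →ₗ[K] K), 3 ≤ m → Nat.card K = 4 →
      Module.finrank K V = m → H.IsSymm → H.Nondegenerate →
      PolarGraphs.IsRamanujan (PolarGraphs.graphNU H)) := by
  refine ⟨fun m V _ _ _ Q hm => ⟨fun hQ => hQ.isRamanujan_graphNOEven hm,
    fun hQ h3 => hQ.isRamanujan_graphNOEven h3, ?_⟩,
    fun m V _ _ _ Q hm hQ => hQ.isRamanujan hm,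
    fun m K V _ _ _ _ _ H hm hK hV hH hnd =>
      PolarGraphs.isRamanujan_graphNU hm hK hV hH hnd⟩
  rintro hQ rfl
  exact hQ.isBipartiteRamanujan_graphNOEven
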